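/- Let $\mathcal H$ be a real Hilbert space with scalar product $\langle\cdot,\cdot\rangle$ and norm $\|\cdot\|$. Let $f,g\colon\mathcal H\to\,]-\infty,+\infty]$ be proper, convex and lower semicontinuous, with $\operatorname{dom} g\subset\operatorname{dom} f$, and let $f$ be Gâteaux differentiable on $\operatorname{dom} g$. Let $0<\nu\le\mu$ and let $(W_k)_{k\in\mathbb N}$ be bounded positive self-adjoint operators on $\mathcal H$; put $\langle u,v\rangle_k=\langle u,W_kv\rangle$, $\|u\|_k^2=\langle u,u\rangle_k$, and assume $\nu\|\cdot\|^2\le\|\cdot\|_k^2\le\mu\|\cdot\|^2$ for every $k$. Assume moreover that at least one of the following holds: (a) there is a summable sequence $(\eta_k)$ in $[0,+\infty[$ with $\|\cdot\|_{k+1}^2\le(1+\eta_k)\|\cdot\|_k^2$ for every $k$; (b) $\sum_k(\mu_k-\nu_k)<+\infty$, where $\mu_k=\sup_{\|u\|=1}\langle u,W_ku\rangle$ and $\nu_k=\inf_{\|u\|=1}\langle u,W_ku\rangle$. Let $\nabla^k f$ be the gradient of $f$ with respect to $\langle\cdot,\cdot\rangle_k$ (so $W_k\nabla^kf=\nabla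 f$), let $\mathrm{prox}^k_{\gamma g}(z)$ be the minimizer of $\gamma g+\tfrac12\|\cdot-z\|_k^2$, and for $x\in\operatorname{dom}g$, $\gamma>0$, $\lambda\in\,]0,1]$ set $$J_k(x,\gamma,\lambda)=x+\lambda\big(\mathrm{prox}^k_{\gamma g}(x-\gamma\nabla^kf(x))-x\big).$$ Let $x_0\in\operatorname{dom} g$, $\gamma_k>0$, $\lambda_k\in\,]0,1]$, $y_k=\mathrm{prox}^k_{\gamma_kg}(x_k-\gamma_k\nabla^kf(x_k))$ and $x_{k+1}=x_k+\lambda_k(y_k-x_k)$ for every $k\in\mathbb N$. Let $\delta,\theta\in\,]0,1[$. Consider the following rules. * LS1: $\inf_k\lambda_k>0$, $\bar\gamma>0$, and for every $k$, $\gamma_k$ is the largest $\gamma\in\{\bar\gamma\theta^i\mid i\in\mathbb N\}$ such that, with $J=J_k(x_k,\gamma,\lambda_k)$, $f(J)-f(x_k)-\langle J-x_k,\nabla f(x_k)\rangle\le\frac{\delta}{\gamma\lambda_k}\|J-x_k\|_k^2$. * LS2: $0<\inf_k\gamma_k\le\sup_k\gamma_k<+\infty$, $\bar\lambda\in\,]0,1]$,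 and for every $k$, $\lambda_k$ is the largest $\lambda\in\{\bar\lambda\theta^i\mid i\in\mathbb N\}$ such that, with $J=J_k(x_k,\gamma_k,\lambda)$, $f(J)-f(x_k)-\langle J-x_k,\nabla f(x_k)\rangle\le\frac{\delta}{\gamma_k\lambda}\|J-x_k\|_k^2$. * LS3: $\inf_k\lambda_k>0$, $\bar\gamma>0$, and for every $k$, $\gamma_k$ is the largest $\gamma\in\{\bar\gamma\theta^i\mid i\in\mathbb N\}$ such that, with $J=J_k(x_k,\gamma,\lambda_k)$, $\|\nabla^kf(J)-\nabla^kf(x_k)\|_k\le\frac{\delta}{\gamma\lambda_k}\|J-x_k\|_k$. * LS4: $0<\inf_k\gamma_k\le\sup_k\gamma_k<+\infty$, $\bar\lambda\in\,]0,1]$, and for every $k$, $\lambda_k$ is the largest $\lambda\in\{\bar\lambda\theta^i\mid i\in\mathbb N\}$ such that, with $J=J_k(x_k,\gamma_k,\lambda)$, $(f+g)(J)-(f+g)(x_k)\le(1-\delta)\lambda\big(g(y_k)-g(x_k)+\langle y_k-x_k,\nabla f(x_k)\rangle\big)$. Then the following hold. (i) Suppose that $\nabla f$ is Lipschitz continuous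 on $\operatorname{dom}g$ with constant $L\ge0$ (with the convention $c/0=+\infty$ for $c>0$). * Under LS1, $\inf_k\gamma_k\ge\min\{\bar\gamma,\,2\delta\theta\nu/(L\sup_k\lambda_k)\}$. * Under LS2 or LS4, $\inf_k\lambda_k\ge\min\{\bar\lambda,\,2\delta\theta\nu/(L\sup_k\gamma_k)\}$. * Under LS3, $\inf_k\gamma_k\ge\min\{\bar\gamma,\,\delta\theta\nu/(L\sup_k\lambda_k)\}$. (ii) Suppose that $\operatorname{argmin}_{\mathcal H}(f+g)\ne\varnothing$, that $\nabla f$ is Lipschitz continuous on every weakly compact subset of $\operatorname{dom}g$, and that one of LS1, LS2, LS3, LS4 holds. Then $\inf_k\gamma_k>0$ and $\inf_k\lambda_k>0$, and consequently $(f+g)(x_k)-\inf_{\mathcal H}(f+g)=o(1/k)$ as $k\to\infty$. -/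

import Mathlib

open Set Filter Topology
open scoped NNReal Asymptotics

noncomputable section

namespace VMFBS

variable {H : Type*} [NormedAddCommGroup H] [InnerProductSpace ℝ H]

/-- Effective domain of an extended-real-valued function. -/
def dom (h : H → EReal) : Set H := {x | h x < ⊤}

/-- `h` is a proper convex lower semicontinuous function `H → ]-∞, +∞]`. -/
structure IsGammaZero (h : H → EReal) : Prop where
  ne_bot : ∀ x, h x ≠ ⊥
  proper : (dom h).Nonempty
  convex : ∀ x y : H, ∀ a b : ℝ, 0 < a → 0 < b → a + b = 1 →
    h (a • x + b • y) ≤ (a : EReal) * h x + (b : EReal) * h y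
  lsc : LowerSemicontinuous h

/-- The set of minimizers of `h`. -/
def argmin (h : H → EReal) : Set H := {x | ∀ z, h x ≤ h z}

/-- The scalar product `⟨x, y⟩_W = ⟨x, W y⟩` with associated operator `W`. -/
def metricInner (W : H →L[ℝ] H) (x y : H) : ℝ := inner ℝ x (W y)

/-- The norm induced by `metricInner W`. -/
def metricNorm (W : H →L[ℝ] H) (x : H) : ℝ := √(metricInner W x x)

/-- The minimum `inf_{‖x‖ = 1} ⟨x, W x⟩` of the spectrum of `W`. -/
def minEig (W : H →L[ℝ] H) : ℝ := ⨅ x : Metric.sphere (0 : H) 1, inner ℝ (x : H) (W x)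

/-- The maximum `sup_{‖x‖ = 1} ⟨x, W x⟩` of the spectrum of `W`. -/
def maxEig (W : H →L[ℝ] H) : ℝ := ⨆ x : Metric.sphere (0 : H) 1, inner ℝ (x : H) (W x)

/-- A sequence of scalar products on `H`, given by their associated positive operators,
whose squared norms lie between `ν ‖·‖²` and `μ ‖·‖²`. -/
structure IsMetricSequence (W : ℕ → H →L[ℝ] H) (ν μ : ℝ) : Prop where
  nu_pos : 0 < ν
  nu_le_mu : ν ≤ μ
  positive : ∀ k, (W k).IsPositive
  lower : ∀ k x, ν * ‖x‖ ^ 2 ≤ metricNorm (W k) x ^ 2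
  upper : ∀ k x, metricNorm (W k) x ^ 2 ≤ μ * ‖x‖ ^ 2

/-- Quasi-monotonicity of the metrics, with summable errors. -/
def QuasiMonotone (W : ℕ → H →L[ℝ] H) : Prop :=
  ∃ η : ℕ → ℝ, (∀ k, 0 ≤ η k) ∧ Summable η ∧
    ∀ k x, metricNorm (W (k + 1)) x ^ 2 ≤ (1 + η k) * metricNorm (W k) x ^ 2

/-- The spectral gaps `μ_k - ν_k` of the metrics are summable. -/
def SummableGap (W : ℕ → H →L[ℝ] H) : Prop :=
  Summable fun k => maxEig (W k) - minEig (W k)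

/-- `u` is the Gâteaux gradient of `h` at `x` in the scalar product `⟨·, ·⟩_W`: for every `d`,
`(h (x + t d) - h x) / t → ⟨d, u⟩_W` as `t → 0`. Finiteness of this limit forces `h (x + t d)`
to be finite for all small `t`, including `t = 0`. -/
def HasGateauxGradientAt (W : H →L[ℝ] H) (h : H → EReal) (x u : H) : Prop :=
  ∀ d : H, (∀ᶠ t : ℝ in 𝓝 0, x + t • d ∈ dom h) ∧
    HasDerivAt (fun t : ℝ => (h (x + t • d)).toReal) (metricInner W d u) 0

/-- The gradient of `h` at `x` in the scalar product `⟨·, ·⟩_W`. -/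
def metricGradient (W : H →L[ℝ] H) (h : H → EReal) (x : H) : H :=
  Classical.epsilon fun u => HasGateauxGradientAt W h x u

/-- The gradient of `h` at `x` in the original scalar product of `H`. -/
def grad (h : H → EReal) (x : H) : H := metricGradient (ContinuousLinearMap.id ℝ H) h x

/-- `h` is Gâteaux differentiable at every point of `A`. -/
def GateauxDifferentiableOn (h : H → EReal) (A : Set H) : Prop :=
  ∀ x ∈ A, ∃ u, HasGateauxGradientAt (ContinuousLinearMap.id ℝ H) h x u

/-- `A` is compact for the weak topology of `H`. -/
def IsWeaklyCompact (A : Set H) : Prop := IsCompact (toWeakSpace ℝ H '' A)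

/-- `p` minimizes `γ g + (1/2) ‖· - z‖_W²`. -/
def IsProx (W : H →L[ℝ] H) (γ : ℝ) (g : H → EReal) (z p : H) : Prop :=
  p ∈ argmin fun q => (γ : EReal) * g q + (((1 / 2) * metricNorm W (q - z) ^ 2 : ℝ) : EReal)

/-- The proximity operator of `γ g` in the metric `W`. -/
def prox (W : H →L[ℝ] H) (γ : ℝ) (g : H → EReal) (z : H) : H :=
  Classical.epsilon fun p => IsProx W γ g z p

/-- The relaxed forward-backward step
`x + lam (prox^W_{γ g} (x - γ ∇^W f x) - x)`. -/
def J (f g : H → EReal) (W : H →L[ℝ] H) (x : H) (γ lam : ℝ) : H :=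
  x + lam • (prox W γ g (x - γ • metricGradient W f x) - x)

/-- The sequences `x`, `y` are generated by the variable metric forward-backward algorithm with
stepsizes `γ` and relaxation parameters `lam`. -/
structure IsVMFBS (f g : H → EReal) (W : ℕ → H →L[ℝ] H) (x y : ℕ → H) (γ lam : ℕ → ℝ) :
    Prop where
  init : x 0 ∈ dom g
  step_pos : ∀ k, 0 < γ k
  relax_pos : ∀ k, 0 < lam k
  relax_le_one : ∀ k, lam k ≤ 1
  backward : ∀ k, y k = prox (W k) (γ k) g (x k - γ k • metricGradient (W k) f (x k))
  update : ∀ k, x (k + 1) = x k + lam k • (y k - x k)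

/-- The descent inequality
`f (J) - f x - ⟨J - x, ∇f x⟩ ≤ δ / (γ lam) ‖J - x‖_W²`, where `J = J f g W x γ lam`. -/
def DescentCond (f g : H → EReal) (W : H →L[ℝ] H) (δ : ℝ) (x : H) (γ lam : ℝ) : Prop :=
  f (J f g W x γ lam) - f x - ((inner ℝ (J f g W x γ lam - x) (grad f x) : ℝ) : EReal)
    ≤ ((δ / (γ * lam) * metricNorm W (J f g W x γ lam - x) ^ 2 : ℝ) : EReal)

/-- The Armijo-type inequality for `f + g` along `y - x`, where `J = J f g W x γ lam`:
`(f + g) (J) - (f + g) x ≤ (1 - δ) lam (g y - g x + ⟨y - x, ∇f x⟩)`. -/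
def ArmijoCond (f g : H → EReal) (W : H →L[ℝ] H) (δ : ℝ) (x y : H) (γ lam : ℝ) : Prop :=
  (f (J f g W x γ lam) + g (J f g W x γ lam)) - (f x + g x)
    ≤ (((1 - δ) * lam : ℝ) : EReal) *
        (g y - g x + ((inner ℝ (y - x) (grad f x) : ℝ) : EReal))

/-- The local Lipschitz-type inequality
`‖∇^W f (J) - ∇^W f x‖_W ≤ δ / (γ lam) ‖J - x‖_W`, where `J = J f g W x γ lam`. -/
def LipschitzCond (f g : H → EReal) (W : H →L[ℝ] H) (δ : ℝ) (x : H) (γ lam : ℝ) : Prop :=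
  metricNorm W (metricGradient W f (J f g W x γ lam) - metricGradient W f x)
    ≤ δ / (γ * lam) * metricNorm W (J f g W x γ lam - x)

/-- `a` is the largest element of `{abar θ^i | i ∈ ℕ}` satisfying `P`. -/
def IsBacktracked (abar θ : ℝ) (P : ℝ → Prop) (a : ℝ) : Prop :=
  IsGreatest {c : ℝ | (∃ i : ℕ, c = abar * θ ^ i) ∧ P c} a

/-- First line search: backtracking on the stepsizes, with the descent inequality. -/
structure LS1 (f g : H → EReal) (W : ℕ → H →L[ℝ] H) (x : ℕ → H) (γ lam : ℕ → ℝ)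
    (δ θ γbar : ℝ) : Prop where
  delta : δ ∈ Ioo (0 : ℝ) 1
  theta : θ ∈ Ioo (0 : ℝ) 1
  bar : 0 < γbar
  inf_relax : 0 < ⨅ k, lam k
  relax_le_one : ∀ k, lam k ≤ 1
  search : ∀ k, IsBacktracked γbar θ (fun c => DescentCond f g (W k) δ (x k) c (lam k)) (γ k)

/-- Second line search: backtracking on the relaxation parameters, with the descent
inequality. -/
structure LS2 (f g : H → EReal) (W : ℕ → H →L[ℝ] H) (x : ℕ → H) (γ lam : ℕ → ℝ)
    (δ θ lambar : ℝ) : Prop where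
  delta : δ ∈ Ioo (0 : ℝ) 1
  theta : θ ∈ Ioo (0 : ℝ) 1
  bar : lambar ∈ Ioc (0 : ℝ) 1
  inf_step : 0 < ⨅ k, γ k
  sup_step : BddAbove (range γ)
  search : ∀ k, IsBacktracked lambar θ (fun c => DescentCond f g (W k) δ (x k) (γ k) c) (lam k)

/-- Third line search: backtracking on the stepsizes, with the local Lipschitz-type
inequality. -/
structure LS3 (f g : H → EReal) (W : ℕ → H →L[ℝ] H) (x : ℕ → H) (γ lam : ℕ → ℝ)
    (δ θ γbar : ℝ) : Prop where
  delta : δ ∈ Ioo (0 : ℝ) 1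
  theta : θ ∈ Ioo (0 : ℝ) 1
  bar : 0 < γbar
  inf_relax : 0 < ⨅ k, lam k
  relax_le_one : ∀ k, lam k ≤ 1
  search : ∀ k, IsBacktracked γbar θ (fun c => LipschitzCond f g (W k) δ (x k) c (lam k)) (γ k)

/-- Fourth line search: backtracking on the relaxation parameters, with the Armijo-type
inequality. -/
structure LS4 (f g : H → EReal) (W : ℕ → H →L[ℝ] H) (x y : ℕ → H) (γ lam : ℕ → ℝ)
    (δ θ lambar : ℝ) : Prop where
  delta : δ ∈ Ioo (0 : ℝ) 1
  theta : θ ∈ Ioo (0 : ℝ) 1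
  bar : lambar ∈ Ioc (0 : ℝ) 1
  inf_step : 0 < ⨅ k, γ k
  sup_step : BddAbove (range γ)
  search : ∀ k,
    IsBacktracked lambar θ (fun c => ArmijoCond f g (W k) δ (x k) (y k) (γ k) c) (lam k)

/-- `min {a, c / (L s)}`, with the convention `c / 0 = +∞` when `L = 0`. -/
def stepBound (a c : ℝ) (L : ℝ≥0) (s : ℝ) : ℝ :=
  if L = 0 then a else min a (c / ((L : ℝ) * s))

end VMFBS

end

/-! Write F = f + g, D_k = g(y_k) - g(x_k) + ⟨y_k - x_k, ∇f(x_k)⟩. The variational inequality of the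
prox, tested at x_k, gives γ_k D_k ≤ -‖y_k - x_k‖_k², so -D_k controls every quadratic error.

Lower bounds. On a convex K ⊆ dom g where ∇f is L-Lipschitz, the descent lemma and ν‖·‖² ≤ ‖·‖_k²
make the tests of LS1, LS2 and LS4 automatic once Lγλ ≤ 2δν, and that of LS3 once Lγλ ≤ δν. If
backtracking rejects anything, the last rejected value violates this inequality, and the accepted
value is θ times it (`IsBacktracked.stepBound_le`). Part (i) is the case K = dom g.

Part (ii). Each test implies F(x_{k+1}) - F(x_k) ≤ (1-δ)λ_k D_k. With the prox inequality at a
minimizer z and convexity of f, this gives a quasi-Fejér inequality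
(`IsSetting.metricNorm_sub_sq_le`) whose error is a multiple of F(x_k) - F(x_{k+1}), hence summable
by telescoping. Either metric assumption lets it be summed (`IsMetricSequence.exists_energy`), so
(x_k) is bounded and Σ γ_k λ_k (F(x_k) - F(z)) < ∞. This needs an upper bound on γ_k but no lower
bound on γ_k or λ_k, so there is no circularity.

Boundedness then yields a convex weakly compact K ⊆ dom g containing iterates and trial points
(`IsVMFBS.exists_weaklyCompact`); the argument of (i) on K bounds γ_k and λ_k away from 0. Thus
F(x_k) - F(z) is summable and nonincreasing, hence o(1/k). -/

noncomputable section
namespace VMFBS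

variable {H : Type*} [NormedAddCommGroup H] [InnerProductSpace ℝ H]

/-! ### Convex lower semicontinuous functions, read through their real values -/

section GammaZero

theorem IsGammaZero.coe_toReal {h : H → EReal} (hh : IsGammaZero h) {x : H} (hx : x ∈ dom h) :
    ((h x).toReal : EReal) = h x :=
  EReal.coe_toReal (ne_of_lt hx) (hh.ne_bot x)

theorem IsGammaZero.mem_dom_and_toReal_le {h : H → EReal} (hh : IsGammaZero h) {x y : H}
    (hx : x ∈ dom h) (hy : y ∈ dom h) {t : ℝ} (h0 : 0 ≤ t) (h1 : t ≤ 1) :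
    x + t • (y - x) ∈ dom h ∧
      (h (x + t • (y - x))).toReal ≤ (1 - t) * (h x).toReal + t * (h y).toReal := by
  rcases h0.eq_or_lt with rfl | h0
  · simpa using hx
  rcases h1.eq_or_lt with rfl | h1
  · simpa using hy
  have e : x + t • (y - x) = (1 - t) • x + t • y := by module
  have key := hh.convex x y (1 - t) t (by linarith) h0 (by ring)
  rw [← e, ← hh.coe_toReal hx, ← hh.coe_toReal hy, ← EReal.coe_mul, ← EReal.coe_mul,
    ← EReal.coe_add] at key
  have hd : x + t • (y - x) ∈ dom h := lt_of_le_of_lt key (EReal.coe_lt_top _)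
  refine ⟨hd, ?_⟩
  rw [← hh.coe_toReal hd] at key
  exact_mod_cast key

theorem IsGammaZero.convex_dom {h : H → EReal} (hh : IsGammaZero h) : Convex ℝ (dom h) := by
  intro x hx y hy a b ha hb hab
  have := (hh.mem_dom_and_toReal_le hx hy hb (by linarith)).1
  obtain rfl : a = 1 - b := by linarith
  convert this using 1
  module

/-- Lower semicontinuity keeps h above h(z) - 1 on a small ball around z; convexity along the
segment from z to a distant x then prevents h from falling faster than linearly. No separation
theorem is needed. -/
theorem IsGammaZero.exists_lower_bound {h : H → EReal} (hh : IsGammaZero h) :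
    ∃ A B : ℝ, 0 ≤ B ∧ ∀ x ∈ dom h, A - B * ‖x‖ ≤ (h x).toReal := by
  obtain ⟨z, hz⟩ := hh.proper
  set c := (h z).toReal with hc
  have hlt : ((c - 1 : ℝ) : EReal) < h z := by
    rw [← hh.coe_toReal hz]
    exact_mod_cast sub_one_lt c
  obtain ⟨r, hr, hball⟩ := Metric.eventually_nhds_iff.1 (hh.lsc z _ hlt)
  set s := r / 2 with hs
  have hs0 : 0 < s := by positivity
  refine ⟨c - 1 - ‖z‖ / s, 1 / s, by positivity, fun x hx => ?_⟩
  have hbound : c - 1 - ‖x - z‖ / s ≤ (h x).toReal := by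
    rcases le_or_gt ‖x - z‖ s with hxs | hxs
    · have h1 : ((c - 1 : ℝ) : EReal) < h x := hball (by rw [dist_eq_norm]; linarith)
      rw [← hh.coe_toReal hx] at h1
      have h2 : c - 1 < (h x).toReal := by exact_mod_cast h1
      have : 0 ≤ ‖x - z‖ / s := by positivity
      linarith
    · have hn : 0 < ‖x - z‖ := hs0.trans hxs
      set t := s / ‖x - z‖ with ht
      have ht0 : 0 < t := by positivity
      have ht1 : t ≤ 1 := by rw [ht, div_le_one hn]; exact hxs.le
      obtain ⟨hd, hle⟩ := hh.mem_dom_and_toReal_le hz hx ht0.le ht1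
      have h1 : ((c - 1 : ℝ) : EReal) < h (z + t • (x - z)) := hball (by
        rw [dist_eq_norm, add_sub_cancel_left, norm_smul, Real.norm_of_nonneg ht0.le, ht,
          div_mul_cancel₀ _ hn.ne']
        linarith)
      rw [← hh.coe_toReal hd] at h1
      have h2 : c - 1 < (h (z + t • (x - z))).toReal := by exact_mod_cast h1
      have h3 : t * (c - 1 / t) ≤ t * (h x).toReal := by
        rw [mul_sub, mul_one_div_cancel ht0.ne']
        linarith
      have h4 := le_of_mul_le_mul_left h3 ht0
      have h5 : 1 / t = ‖x - z‖ / s := by rw [ht, one_div_div]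
      linarith
  have h1 : ‖x - z‖ / s ≤ (‖x‖ + ‖z‖) / s := by
    gcongr
    exact norm_sub_le x z
  have h2 : (‖x‖ + ‖z‖) / s = 1 / s * ‖x‖ + ‖z‖ / s := by ring
  linarith

theorem IsGammaZero.convex_sublevel {h : H → EReal} (hh : IsGammaZero h) (c : ℝ) :
    Convex ℝ {x | h x ≤ c} := by
  intro x hx y hy a b ha hb hab
  have hxd : x ∈ dom h := lt_of_le_of_lt hx (EReal.coe_lt_top _)
  have hyd : y ∈ dom h := lt_of_le_of_lt hy (EReal.coe_lt_top _)
  obtain ⟨hd, hle⟩ := hh.mem_dom_and_toReal_le hxd hyd hb (by linarith)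
  obtain rfl : a = 1 - b := by linarith
  have e : x + b • (y - x) = (1 - b) • x + b • y := by module
  rw [e] at hd hle
  simp only [mem_ofPred_eq] at hx hy ⊢
  rw [← hh.coe_toReal hxd, EReal.coe_le_coe_iff] at hx
  rw [← hh.coe_toReal hyd, EReal.coe_le_coe_iff] at hy
  rw [← hh.coe_toReal hd, EReal.coe_le_coe_iff]
  nlinarith

end GammaZero

/-! ### The variable scalar product -/

section Metric

variable {W : H →L[ℝ] H}

theorem metricInner_comm (hW : W.IsPositive) (x y : H) :
    metricInner W x y = metricInner W y x := by
  unfold metricInner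
  rw [real_inner_comm]
  exact hW.isSymmetric y x

theorem metricNorm_sq (hW : W.IsPositive) (x : H) : metricNorm W x ^ 2 = metricInner W x x :=
  Real.sq_sqrt (hW.inner_nonneg_right x)

theorem metricNorm_nonneg (x : H) : 0 ≤ metricNorm W x := Real.sqrt_nonneg _

theorem metricInner_add_left (x y z : H) :
    metricInner W (x + y) z = metricInner W x z + metricInner W y z := inner_add_left ..

theorem metricInner_sub_left (x y z : H) :
    metricInner W (x - y) z = metricInner W x z - metricInner W y z := inner_sub_left ..

theorem metricInner_smul_left (c : ℝ) (x z : H) :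
    metricInner W (c • x) z = c * metricInner W x z := real_inner_smul_left ..

theorem metricInner_add_right (x y z : H) :
    metricInner W x (y + z) = metricInner W x y + metricInner W x z := by
  simp [metricInner, inner_add_right]

theorem metricInner_sub_right (x y z : H) :
    metricInner W x (y - z) = metricInner W x y - metricInner W x z := by
  simp [metricInner, inner_sub_right]

theorem metricInner_smul_right (c : ℝ) (x z : H) :
    metricInner W x (c • z) = c * metricInner W x z := by
  simp [metricInner, real_inner_smul_right]

theorem metricNorm_add_sq (hW : W.IsPositive) (x y : H) :
    metricNorm W (x + y) ^ 2 =
      metricNorm W x ^ 2 + 2 * metricInner W x y + metricNorm W y ^ 2 := by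
  simp only [metricNorm_sq hW, metricInner_add_left, metricInner_add_right]
  rw [metricInner_comm hW y x]
  ring

theorem metricNorm_sub_sq (hW : W.IsPositive) (x y : H) :
    metricNorm W (x - y) ^ 2 =
      metricNorm W x ^ 2 - 2 * metricInner W x y + metricNorm W y ^ 2 := by
  simp only [metricNorm_sq hW, metricInner_sub_left, metricInner_sub_right]
  rw [metricInner_comm hW y x]
  ring

theorem metricNorm_smul_sq (hW : W.IsPositive) (c : ℝ) (x : H) :
    metricNorm W (c • x) ^ 2 = c ^ 2 * metricNorm W x ^ 2 := by
  simp only [metricNorm_sq hW, metricInner_smul_left, metricInner_smul_right]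
  ring

theorem metricInner_le_mul (hW : W.IsPositive) (x y : H) :
    metricInner W x y ≤ metricNorm W x * metricNorm W y := by
  set a := metricNorm W x
  set b := metricNorm W y
  have ha : 0 ≤ a := metricNorm_nonneg x
  have hb : 0 ≤ b := metricNorm_nonneg y
  have quad : ∀ t : ℝ, 0 ≤ a ^ 2 - 2 * t * metricInner W x y + t ^ 2 * b ^ 2 := fun t => by
    have := metricNorm_sub_sq hW x (t • y)
    rw [metricInner_smul_right, metricNorm_smul_sq hW] at this
    have h0 := sq_nonneg (metricNorm W (x - t • y))
    linarith
  have hd := discrim_le_zero (a := b ^ 2) (b := -2 * metricInner W x y) (c := a ^ 2)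
    (fun t => by have := quad t; nlinarith)
  unfold discrim at hd
  nlinarith [abs_le_of_sq_le_sq' (a := metricInner W x y) (b := a * b) (by nlinarith)
    (by positivity)]

theorem continuous_metricNorm : Continuous (metricNorm W) := by
  unfold metricNorm metricInner
  fun_prop

/-- Lax–Milgram: the lower bound says exactly that the bilinear form of W is coercive. -/
theorem surjective_of_lower [CompleteSpace H] (hW : W.IsPositive) {ν : ℝ} (hν : 0 < ν)
    (hlow : ∀ x, ν * ‖x‖ ^ 2 ≤ metricNorm W x ^ 2) : Function.Surjective W := by
  have hc : IsCoercive ((innerSL ℝ).comp W) := ⟨ν, hν, fun u => by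
    have := hlow u
    rw [metricNorm_sq hW, metricInner_comm hW] at this
    simp only [ContinuousLinearMap.comp_apply, innerSL_apply_apply]
    unfold metricInner at this
    rw [real_inner_comm]
    linarith⟩
  intro v
  refine ⟨hc.continuousLinearEquivOfBilin.symm v, ext_inner_right ℝ fun w => ?_⟩
  have := hc.continuousLinearEquivOfBilin_apply (hc.continuousLinearEquivOfBilin.symm v) w
  rw [ContinuousLinearEquiv.apply_symm_apply] at this
  simpa using this.symm

end Metric

/-! ### Existence and variational inequality of the proximity operator -/

section Prox

variable {W : H →L[ℝ] H} {g : H → EReal} {γ : ℝ}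

/-- The objective is bounded below because the quadratic dominates the linear minorant of g. The
parallelogram identity at midpoints makes a minimizing sequence Cauchy, and lower semicontinuity
passes to its limit. -/
theorem exists_isProx [CompleteSpace H] (hW : W.IsPositive) {ν : ℝ} (hν : 0 < ν)
    (hlow : ∀ x, ν * ‖x‖ ^ 2 ≤ metricNorm W x ^ 2) (hg : IsGammaZero g) (hγ : 0 < γ) (z : H) :
    ∃ p, IsProx W γ g z p := by
  set Φ : H → ℝ := fun q => γ * (g q).toReal + 1 / 2 * metricNorm W (q - z) ^ 2 with hΦ
  obtain ⟨A, B, hB, hAB⟩ := hg.exists_lower_bound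
  have hbdd : BddBelow (Φ '' dom g) := by
    refine ⟨γ * A - γ * B * ‖z‖ - (γ * B) ^ 2 / (2 * ν), ?_⟩
    rintro _ ⟨q, hq, rfl⟩
    have h1 := mul_le_mul_of_nonneg_left (hAB q hq) hγ.le
    have h2 := hlow (q - z)
    have h3 : γ * B * ‖q‖ ≤ γ * B * (‖q - z‖ + ‖z‖) := by
      have : ‖q‖ ≤ ‖q - z‖ + ‖z‖ := by simpa using norm_add_le (q - z) z
      gcongr
    have h4 : γ * B * ‖q - z‖ - (γ * B) ^ 2 / (2 * ν) ≤ 1 / 2 * (ν * ‖q - z‖ ^ 2) := by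
      rw [sub_le_iff_le_add, ← sub_nonneg]
      have : 1 / 2 * (ν * ‖q - z‖ ^ 2) + (γ * B) ^ 2 / (2 * ν) - γ * B * ‖q - z‖ =
        (ν * ‖q - z‖ - γ * B) ^ 2 / (2 * ν) := by field_simp; ring
      rw [this]
      positivity
    simp only [hΦ]
    linarith
  set m := sInf (Φ '' dom g) with hm
  have hle : ∀ q ∈ dom g, m ≤ Φ q := fun q hq => csInf_le hbdd (mem_image_of_mem _ hq)
  have hseq : ∀ n : ℕ, ∃ q ∈ dom g, Φ q < m + 1 / ((n : ℝ) + 1) := fun n => by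
    obtain ⟨_, ⟨q, hq, rfl⟩, hlt⟩ := exists_lt_of_csInf_lt (hg.proper.image Φ)
      (lt_add_of_pos_right m (Nat.one_div_pos_of_nat (α := ℝ) (n := n)))
    exact ⟨q, hq, hlt⟩
  choose q hqd hq using hseq
  have hmid : ∀ a ∈ dom g, ∀ b ∈ dom g,
      m ≤ 1 / 2 * Φ a + 1 / 2 * Φ b - 1 / 8 * metricNorm W (b - a) ^ 2 := fun a ha b hb => by
    obtain ⟨hd, hc⟩ := hg.mem_dom_and_toReal_le ha hb (t := 1 / 2) (by norm_num) (by norm_num)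
    refine (hle _ hd).trans ?_
    have e : metricNorm W (a + (1 / 2 : ℝ) • (b - a) - z) ^ 2 = 1 / 2 * metricNorm W (a - z) ^ 2
        + 1 / 2 * metricNorm W (b - z) ^ 2 - 1 / 4 * metricNorm W (b - a) ^ 2 := by
      have e1 : a + (1 / 2 : ℝ) • (b - a) - z = (a - z) + (1 / 2 : ℝ) • (b - a) := by abel
      have e2 : b - z = (a - z) + (b - a) := by abel
      rw [e1, e2, metricNorm_add_sq hW, metricNorm_add_sq hW, metricNorm_smul_sq hW,
        metricInner_smul_right]
      ring
    simp only [hΦ]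
    rw [e]
    nlinarith [mul_le_mul_of_nonneg_left hc hγ.le]
  have hlim : Tendsto (fun n : ℕ => 1 / ((n : ℝ) + 1)) atTop (𝓝 0) :=
    tendsto_one_div_add_atTop_nhds_zero_nat
  have hcauchy : CauchySeq q := by
    rw [Metric.cauchySeq_iff']
    intro ε hε
    obtain ⟨N, hN⟩ := (hlim.eventually (gt_mem_nhds
      (show 0 < ν * ε ^ 2 / 8 by positivity))).exists
    refine ⟨N, fun n hn => ?_⟩
    have h1 := hmid (q N) (hqd N) (q n) (hqd n)
    have h2 := hq N
    have h3 := hq n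
    have h4 : 1 / ((n : ℝ) + 1) ≤ 1 / ((N : ℝ) + 1) := Nat.one_div_le_one_div hn
    have h5 := hlow (q n - q N)
    rw [dist_eq_norm]
    refine lt_of_pow_lt_pow_left₀ 2 hε.le (lt_of_mul_lt_mul_left ?_ hν.le)
    linarith
  obtain ⟨p, hp⟩ := cauchySeq_tendsto_of_complete hcauchy
  have hEp : Tendsto (fun n => 1 / 2 * metricNorm W (q n - z) ^ 2) atTop
      (𝓝 (1 / 2 * metricNorm W (p - z) ^ 2)) :=
    (((continuous_metricNorm.tendsto _).comp (hp.sub_const z)).pow 2).const_mul _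
  -- Finiteness of g p is not yet known, so every real c < g p is bounded instead; p ∈ dom g then
  -- follows.
  have hgp : g p ≤ (((m - 1 / 2 * metricNorm W (p - z) ^ 2) / γ : ℝ) : EReal) := by
    refine EReal.ge_of_forall_gt_iff_ge.1 fun c hc => ?_
    rw [EReal.coe_le_coe_iff, le_div_iff₀ hγ, le_sub_iff_add_le]
    have hev : ∀ᶠ n in atTop, γ * c + 1 / 2 * metricNorm W (q n - z) ^ 2 ≤
        m + 1 / ((n : ℝ) + 1) := by
      filter_upwards [hp.eventually (hg.lsc p _ hc)] with n hn
      rw [gt_iff_lt, ← hg.coe_toReal (hqd n), EReal.coe_lt_coe_iff] at hn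
      have := mul_le_mul_of_nonneg_left hn.le hγ.le
      have := hq n
      simp only [hΦ] at this
      linarith
    have := le_of_tendsto_of_tendsto (hEp.const_add (γ * c)) (hlim.const_add m) hev
    rw [add_zero] at this
    linarith
  have hpd : p ∈ dom g := lt_of_le_of_lt hgp (EReal.coe_lt_top _)
  refine ⟨p, fun r => ?_⟩
  by_cases hr : r ∈ dom g
  · simp only
    rw [← hg.coe_toReal hpd, ← hg.coe_toReal hr] at *
    have h1 := hle r hr
    rw [EReal.coe_le_coe_iff, le_div_iff₀ hγ] at hgp
    simp only [hΦ] at h1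
    norm_cast
    linarith
  · have : g r = ⊤ := not_lt_top_iff.1 hr
    simp only [this]
    rw [EReal.coe_mul_top_of_pos hγ, EReal.top_add_coe]
    exact le_top

theorem IsProx.mem_dom (hg : IsGammaZero g) (hγ : 0 < γ) {z p : H} (hp : IsProx W γ g z p) :
    p ∈ dom g := by
  obtain ⟨r, hr⟩ := hg.proper
  by_contra hpd
  have h1 : g p = ⊤ := not_lt_top_iff.1 hpd
  have h2 := hp r
  simp only [h1] at h2
  rw [EReal.coe_mul_top_of_pos hγ, EReal.top_add_coe, ← hg.coe_toReal hr] at h2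
  rw [top_le_iff] at h2
  norm_cast at h2
  exact EReal.coe_ne_top _ h2

/-- First-order optimality: compare p with p + t(q - p), divide by t and let t → 0⁺. -/
theorem IsProx.toReal_sub_le (hW : W.IsPositive) (hg : IsGammaZero g) (hγ : 0 < γ) {z p q : H}
    (hp : IsProx W γ g z p) (hq : q ∈ dom g) :
    γ * ((g p).toReal - (g q).toReal) ≤ metricInner W (p - q) (z - p) := by
  have hpd := hp.mem_dom hg hγ
  have key : ∀ t : ℝ, 0 < t → t ≤ 1 →
      γ * ((g p).toReal - (g q).toReal) - metricInner W (p - q) (z - p)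
        ≤ t * (1 / 2 * metricNorm W (q - p) ^ 2) := by
    intro t h0 h1
    obtain ⟨hd, hc⟩ := hg.mem_dom_and_toReal_le hpd hq h0.le h1
    have h2 := hp (p + t • (q - p))
    simp only at h2
    rw [← hg.coe_toReal hpd, ← hg.coe_toReal hd] at h2
    norm_cast at h2
    have e1 : p + t • (q - p) - z = (p - z) + t • (q - p) := by abel
    rw [e1, metricNorm_add_sq hW, metricNorm_smul_sq hW, metricInner_smul_right] at h2
    have e2 : metricInner W (p - z) (q - p) = metricInner W (p - q) (z - p) := by
      rw [metricInner_comm hW, ← neg_sub p q, ← neg_sub z p]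
      simp only [metricInner, map_neg, inner_neg_neg]
    rw [e2] at h2
    have h3 := mul_le_mul_of_nonneg_left hc hγ.le
    refine le_of_mul_le_mul_left ?_ h0
    nlinarith
  have hlim : Tendsto (fun t : ℝ => t * (1 / 2 * metricNorm W (q - p) ^ 2)) (𝓝[>] 0) (𝓝 0) := by
    have : Continuous fun t : ℝ => t * (1 / 2 * metricNorm W (q - p) ^ 2) := by fun_prop
    simpa using (this.tendsto 0).mono_left nhdsWithin_le_nhds
  have := ge_of_tendsto hlim (b := γ * ((g p).toReal - (g q).toReal)
      - metricInner W (p - q) (z - p)) (by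
    filter_upwards [Ioo_mem_nhdsGT (show (0 : ℝ) < 1 by norm_num)] with t ht
    exact key t ht.1 ht.2.le)
  linarith

theorem isProx_prox [CompleteSpace H] (hW : W.IsPositive) {ν : ℝ} (hν : 0 < ν)
    (hlow : ∀ x, ν * ‖x‖ ^ 2 ≤ metricNorm W x ^ 2) (hg : IsGammaZero g) (hγ : 0 < γ) (z : H) :
    IsProx W γ g z (prox W γ g z) :=
  Classical.epsilon_spec (exists_isProx hW hν hlow hg hγ z)

end Prox

/-! ### Gâteaux gradients and the descent lemma -/

section Gradient

variable {W : H →L[ℝ] H} {f : H → EReal} {x u : H}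

theorem hasGateauxGradientAt_grad {A : Set H} (hf : GateauxDifferentiableOn f A) (hx : x ∈ A) :
    HasGateauxGradientAt (ContinuousLinearMap.id ℝ H) f x (grad f x) :=
  Classical.epsilon_spec (hf x hx)

/-- Surjectivity of W provides a gradient in the metric, so the choice defining `metricGradient` is
a genuine one; uniqueness of directional derivatives identifies its image. -/
theorem map_metricGradient [CompleteSpace H] (hW : W.IsPositive) {ν : ℝ} (hν : 0 < ν)
    (hlow : ∀ x, ν * ‖x‖ ^ 2 ≤ metricNorm W x ^ 2) {A : Set H}
    (hf : GateauxDifferentiableOn f A) (hx : x ∈ A) :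
    W (metricGradient W f x) = grad f x := by
  have h := hasGateauxGradientAt_grad hf hx
  obtain ⟨u, hu⟩ := surjective_of_lower hW hν hlow (grad f x)
  have hu' : HasGateauxGradientAt W f x u := fun d => by
    have := h d
    simp only [metricInner, ContinuousLinearMap.id_apply] at this
    simpa only [metricInner, hu] using this
  have h' : HasGateauxGradientAt W f x (metricGradient W f x) :=
    Classical.epsilon_spec (p := fun u => HasGateauxGradientAt W f x u) ⟨u, hu'⟩
  refine ext_inner_left ℝ fun d => ?_
  have := (h' d).2.unique (h d).2
  simpa [metricInner] using this

theorem hasDerivAt_toReal_line {A : Set H} (hf : GateauxDifferentiableOn f A) {d : H} {t : ℝ}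
    (hx : x + t • d ∈ A) :
    HasDerivAt (fun s : ℝ => (f (x + s • d)).toReal) (inner ℝ d (grad f (x + t • d))) t := by
  have h := (hasGateauxGradientAt_grad hf hx d).2
  simp only [metricInner, ContinuousLinearMap.id_apply] at h
  have h2 : HasDerivAt (fun s : ℝ => s - t) 1 t := (hasDerivAt_id t).sub_const t
  rw [← sub_self t] at h
  have h3 := HasDerivAt.comp (h := fun s : ℝ => s - t) t h h2
  refine (h3.congr_deriv (mul_one _)).congr_of_eventuallyEq (Eventually.of_forall fun s => ?_)
  simp only [Function.comp_apply]
  congr 2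
  module

theorem inner_grad_le {A : Set H} (hf : IsGammaZero f) (hd : GateauxDifferentiableOn f A)
    (hx : x ∈ A) (hxf : x ∈ dom f) {z : H} (hz : z ∈ dom f) :
    inner ℝ (z - x) (grad f x) ≤ (f z).toReal - (f x).toReal := by
  have h := hasDerivAt_toReal_line (x := x) (t := 0) (d := z - x) hd (by simpa using hx)
  simp only [zero_smul, add_zero] at h
  have h1 := h.hasDerivWithinAt (s := Ioi 0)
  rw [hasDerivWithinAt_iff_tendsto_slope' (by simp)] at h1
  refine le_of_tendsto h1 ?_
  filter_upwards [Ioo_mem_nhdsGT (show (0 : ℝ) < 1 by norm_num)] with t ht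
  have h2 := (hf.mem_dom_and_toReal_le hxf hz ht.1.le ht.2.le).2
  rw [slope_def_field, div_le_iff₀ (by simpa using ht.1)]
  simp only [zero_smul, add_zero, sub_zero]
  linarith

/-- Only derivatives along the segment are used: subtracting from f its linear part and the
quadratic bound leaves a function ψ of t with nonpositive derivative, so nothing is integrated. -/
theorem descent {A : Set H} (hd : GateauxDifferentiableOn f A) {K : Set H} (hKA : K ⊆ A)
    (hK : Convex ℝ K) {L : ℝ≥0} (hL : LipschitzOnWith L (grad f) K) {z : H} (hx : x ∈ K)
    (hz : z ∈ K) :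
    (f z).toReal - (f x).toReal - inner ℝ (z - x) (grad f x) ≤ L / 2 * ‖z - x‖ ^ 2 := by
  set d := z - x with hdef
  have hmem : ∀ t ∈ Icc (0 : ℝ) 1, x + t • d ∈ K := fun t ht => by
    have := hK hx hz (sub_nonneg.2 ht.2) ht.1 (by ring)
    convert this using 1
    rw [hdef]; module
  set ψ : ℝ → ℝ := fun t => (f (x + t • d)).toReal - t * inner ℝ d (grad f x)
    - L / 2 * ‖d‖ ^ 2 * t ^ 2 with hψ
  have hder : ∀ t ∈ Icc (0 : ℝ) 1, HasDerivAt ψ (inner ℝ d (grad f (x + t • d))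
      - inner ℝ d (grad f x) - L / 2 * ‖d‖ ^ 2 * (2 * t)) t := fun t ht => by
    have h1 := hasDerivAt_toReal_line hd (hKA (hmem t ht))
    have h2 := ((hasDerivAt_id t).mul_const (inner ℝ d (grad f x)))
    have h3 := ((hasDerivAt_pow 2 t).const_mul (L / 2 * ‖d‖ ^ 2))
    have h4 := (h1.sub h2).sub h3
    refine h4.congr_deriv ?_
    norm_num
  have hanti : AntitoneOn ψ (Icc 0 1) := by
    refine antitoneOn_of_deriv_nonpos (convex_Icc 0 1)
      (fun t ht => (hder t ht).continuousAt.continuousWithinAt)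
      (fun t ht => (hder t (interior_subset ht)).differentiableAt.differentiableWithinAt)
      fun t ht => ?_
    have ht' := interior_subset ht
    rw [(hder t ht').deriv, ← inner_sub_right]
    have h1 := real_inner_le_norm d (grad f (x + t • d) - grad f x)
    have h2 := hL.norm_sub_le (hmem t ht') hx
    rw [add_sub_cancel_left, norm_smul, Real.norm_of_nonneg ht'.1] at h2
    have h3 := mul_le_mul_of_nonneg_left h2 (norm_nonneg d)
    nlinarith
  have := hanti (left_mem_Icc.2 zero_le_one) (right_mem_Icc.2 zero_le_one) zero_le_one
  simp only [hψ, one_smul, zero_smul, add_zero] at this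
  rw [show x + d = z by rw [hdef]; abel] at this
  linarith

end Gradient

/-! ### Weak compactness of bounded closed convex sets -/

section WeakCompactness

/-- Banach–Alaoglu, transported by the Riesz isometry, which is continuous from the weak-star to the
weak topology. -/
theorem isCompact_toWeakSpace_closedBall [CompleteSpace H] (R : ℝ) :
    IsCompact (toWeakSpace ℝ H '' Metric.closedBall 0 R) := by
  have hc := WeakDual.isCompact_closedBall (𝕜 := ℝ) (E := H) 0 R
  let T : WeakDual ℝ H → WeakSpace ℝ H := fun φ =>
    toWeakSpace ℝ H ((InnerProductSpace.toDual ℝ H).symm (WeakDual.toStrongDual φ))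
  have hT : Continuous T := by
    refine WeakBilin.continuous_of_continuous_eval _ fun φ => ?_
    have : ∀ a : WeakDual ℝ H, ((topDualPairing ℝ H).flip (T a)) φ =
        a ((InnerProductSpace.toDual ℝ H).symm φ) := fun a => by
      change φ ((InnerProductSpace.toDual ℝ H).symm (WeakDual.toStrongDual a)) = _
      conv_lhs => rw [← (InnerProductSpace.toDual ℝ H).apply_symm_apply φ]
      rw [InnerProductSpace.toDual_apply_apply, real_inner_comm,
        InnerProductSpace.toDual_symm_apply]
      rfl
    simp only [this]
    exact WeakDual.eval_continuous _
  convert hc.image hT using 1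
  ext v
  constructor
  · rintro ⟨w, hw, rfl⟩
    refine ⟨StrongDual.toWeakDual (InnerProductSpace.toDual ℝ H w), ?_, ?_⟩
    · simpa using hw
    · simp [T]
  · rintro ⟨φ, hφ, rfl⟩
    refine ⟨_, ?_, rfl⟩
    simpa using hφ

/-- Mazur: a norm-closed convex set is weakly closed. -/
theorem isWeaklyCompact_of_convex [CompleteSpace H] {K : Set H} (hK : Convex ℝ K)
    (hcl : IsClosed K) {R : ℝ} (hR : K ⊆ Metric.closedBall 0 R) : IsWeaklyCompact K := by
  refine (isCompact_toWeakSpace_closedBall R).of_isClosed_subset ?_ (image_mono hR)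
  rw [← closure_eq_iff_isClosed, ← Convex.toWeakSpace_closure ℝ hK, hcl.closure_eq]

end WeakCompactness

/-- The standing assumptions on the objective and on a single metric. -/
structure IsSetting (f g : H → EReal) (W : H →L[ℝ] H) (ν : ℝ) : Prop where
  left : IsGammaZero f
  right : IsGammaZero g
  dom_subset : dom g ⊆ dom f
  diff : GateauxDifferentiableOn f (dom g)
  positive : W.IsPositive
  nu_pos : 0 < ν
  lower : ∀ x, ν * ‖x‖ ^ 2 ≤ metricNorm W x ^ 2

/-- The forward-backward point `prox^W_{γ g} (x - γ ∇^W f x)`. -/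
def fbStep (f g : H → EReal) (W : H →L[ℝ] H) (γ : ℝ) (x : H) : H :=
  prox W γ g (x - γ • metricGradient W f x)

/-- The linearized decrease `g y - g x + ⟨y - x, ∇f x⟩`. -/
def linDecrease (f g : H → EReal) (x y : H) : ℝ :=
  (g y).toReal - (g x).toReal + inner ℝ (y - x) (grad f x)

/-- The real-valued objective `f + g`. -/
def objective (f g : H → EReal) (x : H) : ℝ := (f x).toReal + (g x).toReal

/-! ### One forward-backward step -/

section SingleStep

variable {f g : H → EReal} {W : H →L[ℝ] H} {ν δ γ lam : ℝ} {x y z : H}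

theorem J_eq : J f g W x γ lam = x + lam • (fbStep f g W γ x - x) := rfl

theorem IsSetting.coe_add (S : IsSetting f g W ν) (hx : x ∈ dom g) :
    f x + g x = ((objective f g x : ℝ) : EReal) := by
  rw [objective, EReal.coe_add, S.left.coe_toReal (S.dom_subset hx), S.right.coe_toReal hx]

theorem IsSetting.descentCond_iff (S : IsSetting f g W ν) (hx : x ∈ dom g)
    (hJ : J f g W x γ lam ∈ dom g) :
    DescentCond f g W δ x γ lam ↔
      (f (J f g W x γ lam)).toReal - (f x).toReal - inner ℝ (J f g W x γ lam - x) (grad f x)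
        ≤ δ / (γ * lam) * metricNorm W (J f g W x γ lam - x) ^ 2 := by
  unfold DescentCond
  rw [← S.left.coe_toReal (S.dom_subset hx), ← S.left.coe_toReal (S.dom_subset hJ)]
  simp only [EReal.toReal_coe]
  norm_cast

theorem IsSetting.armijoCond_iff (S : IsSetting f g W ν) (hx : x ∈ dom g) (hy : y ∈ dom g)
    (hJ : J f g W x γ lam ∈ dom g) :
    ArmijoCond f g W δ x y γ lam ↔
      objective f g (J f g W x γ lam) - objective f g x ≤ (1 - δ) * lam * linDecrease f g x y := by
  unfold ArmijoCond
  rw [S.coe_add hx, S.coe_add hJ, ← S.right.coe_toReal hx, ← S.right.coe_toReal hy, linDecrease]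
  norm_cast

theorem J_mem_of_convex {K : Set H} (hK : Convex ℝ K) (hl : 0 ≤ lam) (hl1 : lam ≤ 1)
    (hx : x ∈ K) (hy : fbStep f g W γ x ∈ K) : J f g W x γ lam ∈ K := by
  have := hK hx hy (sub_nonneg.2 hl1) hl (by ring)
  convert this using 1
  rw [J_eq]
  module

theorem IsSetting.descentCond_of_le (S : IsSetting f g W ν) {K : Set H} (hKg : K ⊆ dom g)
    (hK : Convex ℝ K) {L : ℝ≥0} (hL : LipschitzOnWith L (grad f) K) (hδ : 0 < δ) (hγ : 0 < γ)
    (hl : 0 < lam) (hl1 : lam ≤ 1) (hx : x ∈ K) (hy : fbStep f g W γ x ∈ K)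
    (hsmall : L * (γ * lam) ≤ 2 * δ * ν) : DescentCond f g W δ x γ lam := by
  have hJ : J f g W x γ lam ∈ K := J_mem_of_convex hK hl.le hl1 hx hy
  rw [S.descentCond_iff (hKg hx) (hKg hJ)]
  refine (descent S.diff hKg hK hL hx hJ).trans ?_
  have h1 := S.lower (J f g W x γ lam - x)
  have h2 : (L : ℝ) / 2 ≤ δ / (γ * lam) * ν := by
    rw [div_mul_eq_mul_div, le_div_iff₀ (by positivity)]
    linarith
  calc (L : ℝ) / 2 * ‖J f g W x γ lam - x‖ ^ 2
      ≤ δ / (γ * lam) * ν * ‖J f g W x γ lam - x‖ ^ 2 := by gcongr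
    _ = δ / (γ * lam) * (ν * ‖J f g W x γ lam - x‖ ^ 2) := by ring
    _ ≤ _ := by gcongr

variable [CompleteSpace H]

theorem IsSetting.fbStep_mem (S : IsSetting f g W ν) (hγ : 0 < γ) : fbStep f g W γ x ∈ dom g :=
  (isProx_prox S.positive S.nu_pos S.lower S.right hγ _).mem_dom S.right hγ

theorem IsSetting.fbStep_le (S : IsSetting f g W ν) (hγ : 0 < γ) (hx : x ∈ dom g)
    (hz : z ∈ dom g) :
    γ * ((g (fbStep f g W γ x)).toReal - (g z).toReal) ≤
      metricInner W (fbStep f g W γ x - z) (x - fbStep f g W γ x)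
        - γ * inner ℝ (fbStep f g W γ x - z) (grad f x) := by
  have h := (isProx_prox S.positive S.nu_pos S.lower S.right hγ
    (x - γ • metricGradient W f x)).toReal_sub_le S.positive S.right hγ hz
  change γ * ((g (fbStep f g W γ x)).toReal - (g z).toReal) ≤
    metricInner W (fbStep f g W γ x - z) (x - γ • metricGradient W f x - fbStep f g W γ x) at h
  rw [sub_right_comm, metricInner_sub_right, metricInner_smul_right] at h
  conv_rhs at h =>
    rw [metricInner.eq_def W _ (metricGradient W f x),
      map_metricGradient S.positive S.nu_pos S.lower S.diff hx]
  exact h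

theorem IsSetting.linDecrease_le (S : IsSetting f g W ν) (hγ : 0 < γ) (hx : x ∈ dom g) :
    γ * linDecrease f g x (fbStep f g W γ x) ≤ -metricNorm W (fbStep f g W γ x - x) ^ 2 := by
  have h := S.fbStep_le hγ hx hx
  have e : metricInner W (fbStep f g W γ x - x) (x - fbStep f g W γ x) =
      -metricNorm W (fbStep f g W γ x - x) ^ 2 := by
    rw [metricNorm_sq S.positive, ← neg_sub (fbStep f g W γ x) x]
    simp only [metricInner, map_neg, inner_neg_right]
  rw [e] at h
  unfold linDecrease
  linarith

theorem IsSetting.J_mem (S : IsSetting f g W ν) (hγ : 0 < γ) (hl : 0 ≤ lam) (hl1 : lam ≤ 1)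
    (hx : x ∈ dom g) : J f g W x γ lam ∈ dom g :=
  (S.right.mem_dom_and_toReal_le hx (S.fbStep_mem hγ) hl hl1).1

theorem IsSetting.armijoCond_of_le (S : IsSetting f g W ν) {K : Set H} (hKg : K ⊆ dom g)
    (hK : Convex ℝ K) {L : ℝ≥0} (hL : LipschitzOnWith L (grad f) K) (hδ : 0 < δ) (hγ : 0 < γ)
    (hl : 0 < lam) (hl1 : lam ≤ 1) (hx : x ∈ K) (hy : fbStep f g W γ x ∈ K)
    (hsmall : L * (γ * lam) ≤ 2 * δ * ν) : ArmijoCond f g W δ x (fbStep f g W γ x) γ lam := by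
  have hJ : J f g W x γ lam ∈ K := J_mem_of_convex hK hl.le hl1 hx hy
  rw [S.armijoCond_iff (hKg hx) (hKg hy) (hKg hJ)]
  have h1 := descent S.diff hKg hK hL hx hJ
  have h2 := (S.right.mem_dom_and_toReal_le (hKg hx) (hKg hy) hl.le hl1).2
  have h3 := S.linDecrease_le hγ (hKg hx)
  have h4 := S.lower (fbStep f g W γ x - x)
  rw [J_eq] at h1 ⊢
  rw [add_sub_cancel_left, real_inner_smul_left, norm_smul, Real.norm_of_nonneg hl.le] at h1
  unfold objective
  set D := linDecrease f g x (fbStep f g W γ x) with hD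
  unfold linDecrease at hD
  set n := ‖fbStep f g W γ x - x‖
  -- The fraction δ of the linearized decrease, given up in the Armijo test, absorbs the quadratic
  -- error of the descent lemma.
  have h5 : L / 2 * (lam * n) ^ 2 ≤ -(δ * lam * D) := by
    refine le_of_mul_le_mul_left ?_ hγ
    have h6 := mul_le_mul_of_nonneg_right hsmall (show 0 ≤ lam * n ^ 2 / 2 by positivity)
    have h7 := mul_le_mul_of_nonneg_left (h4.trans (le_neg.1 h3))
      (show 0 ≤ δ * lam by positivity)
    linarith
  have h8 : lam * D = lam * ((g (fbStep f g W γ x)).toReal - (g x).toReal)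
      + lam * inner ℝ (fbStep f g W γ x - x) (grad f x) := by rw [hD]; ring
  linarith

theorem IsSetting.lipschitzCond_of_le (S : IsSetting f g W ν) {K : Set H} (hKg : K ⊆ dom g)
    (hK : Convex ℝ K) {L : ℝ≥0} (hL : LipschitzOnWith L (grad f) K) (hγ : 0 < γ)
    (hl : 0 < lam) (hl1 : lam ≤ 1) (hx : x ∈ K) (hy : fbStep f g W γ x ∈ K)
    (hsmall : L * (γ * lam) ≤ δ * ν) : LipschitzCond f g W δ x γ lam := by
  have hJ : J f g W x γ lam ∈ K := J_mem_of_convex hK hl.le hl1 hx hy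
  have hν := S.nu_pos
  unfold LipschitzCond
  set w := J f g W x γ lam
  set u := metricGradient W f w - metricGradient W f x with hu
  have hWu : W u = grad f w - grad f x := by
    rw [hu, map_sub, map_metricGradient S.positive hν S.lower S.diff (hKg hJ),
      map_metricGradient S.positive hν S.lower S.diff (hKg hx)]
  have hb := S.lower (w - x)
  have hu0 := S.lower u
  have ha : metricNorm W u ^ 2 ≤ ‖u‖ * ‖W u‖ := by
    rw [metricNorm_sq S.positive]
    exact real_inner_le_norm _ _
  have hv : ‖W u‖ ≤ L * ‖w - x‖ := hWu ▸ hL.norm_sub_le hJ hx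
  set a := metricNorm W u
  set b := metricNorm W (w - x)
  have ha0 : 0 ≤ a := metricNorm_nonneg _
  have hb0 : 0 ≤ b := metricNorm_nonneg _
  have h1 : a ^ 2 ≤ ‖u‖ * (L * ‖w - x‖) := ha.trans (by gcongr)
  have h2 : √ν * ‖u‖ ≤ a := by
    refine (pow_le_pow_iff_left₀ (by positivity) ha0 two_ne_zero).1 ?_
    rwa [mul_pow, Real.sq_sqrt hν.le]
  have h3 : √ν * ‖w - x‖ ≤ b := by
    refine (pow_le_pow_iff_left₀ (by positivity) hb0 two_ne_zero).1 ?_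
    rwa [mul_pow, Real.sq_sqrt hν.le]
  -- Each of ‖u‖ and ‖w - x‖ costs one factor √ν, so only a single ν is lost. Cancelling a
  -- afterwards needs a separate case a = 0.
  have h4 : ν * a ^ 2 ≤ L * b * a := by
    have h5 : (√ν * ‖u‖) * (√ν * ‖w - x‖) ≤ a * b := by gcongr
    have h6 : (√ν * ‖u‖) * (√ν * ‖w - x‖) = ν * (‖u‖ * ‖w - x‖) := by
      nth_rewrite 3 [← Real.mul_self_sqrt hν.le]
      ring
    rw [h6] at h5
    have h7 := mul_le_mul_of_nonneg_left h1 hν.le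
    have h8 := mul_le_mul_of_nonneg_left h5 L.coe_nonneg
    linarith
  have h5 : ν * a ≤ L * b := by
    rcases ha0.eq_or_lt with h | h
    · rw [← h, mul_zero]
      positivity
    · refine le_of_mul_le_mul_right ?_ h
      linarith
  rw [div_mul_eq_mul_div, le_div_iff₀ (by positivity)]
  refine le_of_mul_le_mul_left ?_ hν
  calc ν * (a * (γ * lam)) = ν * a * (γ * lam) := by ring
    _ ≤ L * b * (γ * lam) := by gcongr
    _ = L * (γ * lam) * b := by ring
    _ ≤ δ * ν * b := by gcongr
    _ = ν * (δ * b) := by ring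

theorem IsSetting.objective_sub_le_of_descentCond (S : IsSetting f g W ν) (hγ : 0 < γ)
    (hl : 0 < lam) (hl1 : lam ≤ 1) (hx : x ∈ dom g) (hδ : 0 < δ)
    (h : DescentCond f g W δ x γ lam) :
    objective f g (J f g W x γ lam) - objective f g x
      ≤ (1 - δ) * lam * linDecrease f g x (fbStep f g W γ x) := by
  rw [S.descentCond_iff hx (S.J_mem hγ hl.le hl1 hx)] at h
  have h2 := (S.right.mem_dom_and_toReal_le hx (S.fbStep_mem (x := x) hγ) hl.le hl1).2
  have h3 := S.linDecrease_le hγ hx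
  rw [J_eq] at h ⊢
  rw [add_sub_cancel_left, real_inner_smul_left, metricNorm_smul_sq S.positive] at h
  unfold objective
  set D := linDecrease f g x (fbStep f g W γ x) with hD
  unfold linDecrease at hD
  set E := metricNorm W (fbStep f g W γ x - x) ^ 2
  have h5 : δ / (γ * lam) * (lam ^ 2 * E) ≤ -(δ * lam * D) := by
    have e : δ / (γ * lam) * (lam ^ 2 * E) = δ * lam * E / γ := by field_simp
    rw [e, div_le_iff₀ hγ]
    have := mul_le_mul_of_nonneg_left (le_neg.1 h3) (show 0 ≤ δ * lam by positivity)
    linarith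
  have h8 : lam * D = lam * ((g (fbStep f g W γ x)).toReal - (g x).toReal)
      + lam * inner ℝ (fbStep f g W γ x - x) (grad f x) := by rw [hD]; ring
  linarith

/-- Convexity at w = J gives f(w) - f(x) ≤ ⟨w - x, ∇f(w)⟩; subtract ⟨w - x, ∇f(x)⟩ and apply
Cauchy–Schwarz in the metric. This reduces LS3 to the descent test. -/
theorem IsSetting.descentCond_of_lipschitzCond (S : IsSetting f g W ν) (hγ : 0 < γ)
    (hl : 0 < lam) (hl1 : lam ≤ 1) (hx : x ∈ dom g)
    (h : LipschitzCond f g W δ x γ lam) : DescentCond f g W δ x γ lam := by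
  have hJ := S.J_mem hγ hl.le hl1 hx
  rw [S.descentCond_iff hx hJ]
  unfold LipschitzCond at h
  set w := J f g W x γ lam
  have h1 := inner_grad_le S.left S.diff hJ (S.dom_subset hJ) (S.dom_subset hx)
  have h2 := metricInner_le_mul S.positive (w - x) (metricGradient W f w - metricGradient W f x)
  rw [metricInner, map_sub, map_metricGradient S.positive S.nu_pos S.lower S.diff hJ,
    map_metricGradient S.positive S.nu_pos S.lower S.diff hx, inner_sub_right] at h2
  have h3 := mul_le_mul_of_nonneg_left h (metricNorm_nonneg (W := W) (w - x))
  have h4 : inner ℝ (x - w) (grad f w) = -inner ℝ (w - x) (grad f w) := by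
    rw [← inner_neg_left, neg_sub]
  nlinarith

/-- The quasi-Fejér inequality of a single step, for steps satisfying the Armijo inequality. -/
theorem IsSetting.metricNorm_sub_sq_le (S : IsSetting f g W ν) (hγ : 0 < γ)
    (hl : 0 < lam) (hl1 : lam ≤ 1) (hx : x ∈ dom g) (hδ1 : δ < 1)
    (h : objective f g (J f g W x γ lam) - objective f g x
      ≤ (1 - δ) * lam * linDecrease f g x (fbStep f g W γ x)) (hz : z ∈ dom g) :
    metricNorm W (J f g W x γ lam - z) ^ 2 ≤ metricNorm W (x - z) ^ 2
      - 2 * (γ * lam) * (objective f g x - objective f g z)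
      + 2 * γ / (1 - δ) * (objective f g x - objective f g (J f g W x γ lam)) := by
  have h1 := S.fbStep_le hγ hx hz
  have h2 := inner_grad_le S.left S.diff hx (S.dom_subset hx) (S.dom_subset hz)
  rw [J_eq] at h ⊢
  set y := fbStep f g W γ x
  set D := linDecrease f g x y with hD
  unfold linDecrease at hD
  have e1 : inner ℝ (y - x) (grad f x) =
      inner ℝ (y - z) (grad f x) + inner ℝ (z - x) (grad f x) := by
    rw [← inner_add_left, sub_add_sub_cancel]
  have e2 : metricInner W (y - z) (x - y) = -metricNorm W (y - x) ^ 2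
      - metricInner W (x - z) (y - x) := by
    rw [metricNorm_sq S.positive, show y - z = (y - x) + (x - z) by abel, metricInner_add_left,
      ← neg_sub y x]
    simp only [metricInner, map_neg, inner_neg_right]
    ring
  have e3 : x + lam • (y - x) - z = (x - z) + lam • (y - x) := by abel
  rw [e3, metricNorm_add_sq S.positive, metricNorm_smul_sq S.positive, metricInner_smul_right]
  set E := metricNorm W (y - x) ^ 2
  set Fx := objective f g x with hFx
  set Fz := objective f g z with hFz
  set F1 := objective f g (x + lam • (y - x))
  unfold objective at hFx hFz
  have hE : 0 ≤ E := sq_nonneg _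
  have h3 : 2 * γ / (1 - δ) * (Fx - F1) ≥ -(2 * γ * lam * D) := by
    have hd : 0 < 1 - δ := by linarith
    rw [ge_iff_le, div_mul_eq_mul_div, le_div_iff₀ hd]
    have := mul_le_mul_of_nonneg_left h (show 0 ≤ 2 * γ by positivity)
    linarith
  -- The prox inequality at z combined with the gradient inequality of f between x and z.
  have h4 : γ * D ≤ γ * (Fz - Fx) - E - metricInner W (x - z) (y - x) := by
    have h5 := mul_le_mul_of_nonneg_left h2 hγ.le
    have e4 : γ * D = γ * ((g y).toReal - (g z).toReal) + γ * ((g z).toReal - (g x).toReal)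
      + γ * inner ℝ (y - z) (grad f x) + γ * inner ℝ (z - x) (grad f x) := by
      rw [hD, e1]; ring
    rw [e2] at h1
    have e5 : γ * (Fz - Fx) = γ * ((f z).toReal - (f x).toReal)
      + γ * ((g z).toReal - (g x).toReal) := by rw [hFx, hFz]; ring
    linarith
  have h5 := mul_le_mul_of_nonneg_left h4 hl.le
  -- Here lam ≤ 1 enters: lam²E is absorbed by the -2 lam E coming from the cross term.
  have h6 : lam ^ 2 * E ≤ lam * E := by
    gcongr
    nlinarith
  nlinarith [mul_nonneg hl.le hE]

end SingleStep

/-! ### Backtracking on an abstract test -/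

section Backtracking

theorem IsBacktracked.le_bar {abar θ a : ℝ} {P : ℝ → Prop} (h : IsBacktracked abar θ P a)
    (hb : 0 < abar) (hθ : θ ∈ Ioo (0 : ℝ) 1) : a ≤ abar := by
  obtain ⟨⟨i, rfl⟩, -⟩ := h.1
  exact mul_le_of_le_one_right hb.le (pow_le_one₀ hθ.1.le hθ.2.le)

theorem IsBacktracked.stepBound_le {abar θ a C s : ℝ} {P : ℝ → Prop} {L : ℝ≥0}
    (h : IsBacktracked abar θ P a) (hb : 0 < abar) (hθ : θ ∈ Ioo (0 : ℝ) 1) (hs : 0 < s)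
    (hC0 : 0 ≤ C)
    (hP : ∀ c, 0 < c → c ≤ abar → L * (c * s) ≤ C → P c) :
    stepBound abar (C * θ) L s ≤ a := by
  have hθ0 := hθ.1
  obtain ⟨⟨i, hi⟩, -⟩ := h.1
  rcases i with _ | i
  · rw [pow_zero, mul_one] at hi
    rw [hi, stepBound]
    split_ifs
    · exact le_rfl
    · exact min_le_left _ _
  have hc0 : 0 < abar * θ ^ i := by positivity
  have hlt : a < abar * θ ^ i := by
    rw [hi, pow_succ, ← mul_assoc]
    exact mul_lt_of_lt_one_right hc0 hθ.2
  -- The trial value just before the accepted one is larger, hence failed the test.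
  have hnot : ¬ P (abar * θ ^ i) := fun hp => not_lt_of_ge (h.2 ⟨⟨i, rfl⟩, hp⟩) hlt
  have hC : C < L * (abar * θ ^ i * s) := by
    by_contra! hle
    exact hnot (hP _ hc0 (mul_le_of_le_one_right hb.le (pow_le_one₀ hθ.1.le hθ.2.le)) hle)
  rw [stepBound]
  split_ifs with hL
  · rw [hL, NNReal.coe_zero, zero_mul] at hC
    linarith
  · have hL0 : (0 : ℝ) < L := lt_of_le_of_ne L.coe_nonneg (by exact_mod_cast Ne.symm hL)
    refine (min_le_right _ _).trans ?_
    rw [div_le_iff₀ (by positivity), hi, pow_succ]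
    nlinarith

theorem stepBound_pos {a c s : ℝ} {L : ℝ≥0} (ha : 0 < a) (hc : 0 < c) (hs : 0 < s) :
    0 < stepBound a c L s := by
  rw [stepBound]
  split_ifs with hL
  · exact ha
  · have hL0 : (0 : ℝ) < L := lt_of_le_of_ne L.coe_nonneg (by exact_mod_cast Ne.symm hL)
    exact lt_min ha (by positivity)

end Backtracking

/-! ### Lower bounds for the four line searches, relative to a convex set -/

section StepBounds

variable {f g : H → EReal} {W : ℕ → H →L[ℝ] H} {ν : ℝ} {x y : ℕ → H}
  {γ lam : ℕ → ℝ} {δ θ bar : ℝ} {K : Set H} {L : ℝ≥0}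

theorem IsVMFBS.y_eq (halg : IsVMFBS f g W x y γ lam) (k : ℕ) :
    y k = fbStep f g (W k) (γ k) (x k) := halg.backward k

theorem IsVMFBS.x_succ (halg : IsVMFBS f g W x y γ lam) (k : ℕ) :
    x (k + 1) = J f g (W k) (x k) (γ k) (lam k) := by
  rw [halg.update, halg.y_eq, J_eq]

theorem IsVMFBS.le_iSup_relax (halg : IsVMFBS f g W x y γ lam) (k : ℕ) : lam k ≤ ⨆ k, lam k :=
  le_ciSup ⟨1, by rintro _ ⟨k, rfl⟩; exact halg.relax_le_one k⟩ k

/-- Rejected stepsizes have forward-backward points of their own, so K must contain these for all c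
≤ bar. In LS2 and LS4 the stepsize is fixed during the search and y k suffices. -/
theorem LS1.stepBound_le (hls : LS1 f g W x γ lam δ θ bar) (halg : IsVMFBS f g W x y γ lam)
    (S : ∀ k, IsSetting f g (W k) ν) (hKg : K ⊆ dom g) (hK : Convex ℝ K)
    (hL : LipschitzOnWith L (grad f) K) (hxK : ∀ k, x k ∈ K)
    (hyK : ∀ k c, 0 < c → c ≤ bar → fbStep f g (W k) c (x k) ∈ K) :
    stepBound bar (2 * δ * θ * ν) L (⨆ k, lam k) ≤ ⨅ k, γ k := by
  have hν := (S 0).nu_pos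
  have hδ := hls.delta.1
  have hs : 0 < ⨆ k, lam k := (halg.relax_pos 0).trans_le (halg.le_iSup_relax 0)
  refine le_ciInf fun k => ?_
  rw [show 2 * δ * θ * ν = 2 * δ * ν * θ by ring]
  refine (hls.search k).stepBound_le hls.bar hls.theta hs (by positivity) fun c h0 h1 h2 => ?_
  refine (S k).descentCond_of_le hKg hK hL hδ h0 (halg.relax_pos k) (halg.relax_le_one k)
    (hxK k) (hyK k c h0 h1) (le_trans ?_ h2)
  gcongr
  exact halg.le_iSup_relax k

theorem LS2.stepBound_le (hls : LS2 f g W x γ lam δ θ bar) (halg : IsVMFBS f g W x y γ lam)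
    (S : ∀ k, IsSetting f g (W k) ν) (hKg : K ⊆ dom g) (hK : Convex ℝ K)
    (hL : LipschitzOnWith L (grad f) K) (hxK : ∀ k, x k ∈ K) (hyK : ∀ k, y k ∈ K) :
    stepBound bar (2 * δ * θ * ν) L (⨆ k, γ k) ≤ ⨅ k, lam k := by
  have hν := (S 0).nu_pos
  have hδ := hls.delta.1
  have hs : 0 < ⨆ k, γ k := (halg.step_pos 0).trans_le (le_ciSup hls.sup_step 0)
  refine le_ciInf fun k => ?_
  rw [show 2 * δ * θ * ν = 2 * δ * ν * θ by ring]
  refine (hls.search k).stepBound_le hls.bar.1 hls.theta hs (by positivity) fun c h0 h1 h2 => ?_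
  refine (S k).descentCond_of_le hKg hK hL hδ (halg.step_pos k) h0 (h1.trans hls.bar.2)
    (hxK k) (halg.y_eq k ▸ hyK k) (le_trans ?_ h2)
  rw [mul_comm (γ k)]
  gcongr
  exact le_ciSup hls.sup_step k

variable [CompleteSpace H]

theorem IsVMFBS.mem_dom (halg : IsVMFBS f g W x y γ lam) (S : ∀ k, IsSetting f g (W k) ν)
    (k : ℕ) : x k ∈ dom g := by
  induction k with
  | zero => exact halg.init
  | succ k ih =>
    rw [halg.x_succ]
    exact (S k).J_mem (halg.step_pos k) (halg.relax_pos k).le (halg.relax_le_one k) ih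

theorem LS3.stepBound_le (hls : LS3 f g W x γ lam δ θ bar) (halg : IsVMFBS f g W x y γ lam)
    (S : ∀ k, IsSetting f g (W k) ν) (hKg : K ⊆ dom g) (hK : Convex ℝ K)
    (hL : LipschitzOnWith L (grad f) K) (hxK : ∀ k, x k ∈ K)
    (hyK : ∀ k c, 0 < c → c ≤ bar → fbStep f g (W k) c (x k) ∈ K) :
    stepBound bar (δ * θ * ν) L (⨆ k, lam k) ≤ ⨅ k, γ k := by
  have hν := (S 0).nu_pos
  have hδ := hls.delta.1
  have hs : 0 < ⨆ k, lam k := (halg.relax_pos 0).trans_le (halg.le_iSup_relax 0)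
  refine le_ciInf fun k => ?_
  rw [show δ * θ * ν = δ * ν * θ by ring]
  refine (hls.search k).stepBound_le hls.bar hls.theta hs (by positivity) fun c h0 h1 h2 => ?_
  refine (S k).lipschitzCond_of_le hKg hK hL h0 (halg.relax_pos k) (halg.relax_le_one k)
    (hxK k) (hyK k c h0 h1) (le_trans ?_ h2)
  gcongr
  exact halg.le_iSup_relax k

theorem LS4.stepBound_le (hls : LS4 f g W x y γ lam δ θ bar) (halg : IsVMFBS f g W x y γ lam)
    (S : ∀ k, IsSetting f g (W k) ν) (hKg : K ⊆ dom g) (hK : Convex ℝ K)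
    (hL : LipschitzOnWith L (grad f) K) (hxK : ∀ k, x k ∈ K) (hyK : ∀ k, y k ∈ K) :
    stepBound bar (2 * δ * θ * ν) L (⨆ k, γ k) ≤ ⨅ k, lam k := by
  have hν := (S 0).nu_pos
  have hδ := hls.delta.1
  have hs : 0 < ⨆ k, γ k := (halg.step_pos 0).trans_le (le_ciSup hls.sup_step 0)
  refine le_ciInf fun k => ?_
  rw [show 2 * δ * θ * ν = 2 * δ * ν * θ by ring]
  refine (hls.search k).stepBound_le hls.bar.1 hls.theta hs (by positivity) fun c h0 h1 h2 => ?_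
  have h := (S k).armijoCond_of_le hKg hK hL hδ (halg.step_pos k) h0 (h1.trans hls.bar.2)
    (hxK k) (halg.y_eq k ▸ hyK k) (le_trans (by
      rw [mul_comm (γ k)]
      gcongr
      exact le_ciSup hls.sup_step k) h2)
  rwa [← halg.y_eq k] at h

end StepBounds

/-! ### Two facts on real sequences -/

section RealSequences

/-- Discrete Gronwall: the factors 1 + η k accumulate to at most exp(Σ η). -/
theorem bounded_and_summable_of_quasiFejer {a η e b : ℕ → ℝ} (ha : ∀ k, 0 ≤ a k)
    (hη : ∀ k, 0 ≤ η k) (he : ∀ k, 0 ≤ e k) (hb : ∀ k, 0 ≤ b k) (hηs : Summable η)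
    (hes : Summable e) (h : ∀ k, a (k + 1) ≤ (1 + η k) * a k + e k - b k) :
    (∃ M, ∀ k, a k ≤ M) ∧ Summable b := by
  have key : ∀ n, a n + ∑ i ∈ Finset.range n, b i ≤
      (∏ i ∈ Finset.range n, (1 + η i)) * (a 0 + ∑ i ∈ Finset.range n, e i) := fun n => by
    induction n with
    | zero => simp
    | succ n ih =>
      rw [Finset.sum_range_succ, Finset.sum_range_succ, Finset.prod_range_succ]
      have hP : 1 ≤ (∏ i ∈ Finset.range n, (1 + η i)) * (1 + η n) := by
        rw [← Finset.prod_range_succ]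
        exact Finset.one_le_prod fun i _ => by linarith [hη i]
      have h1 := mul_le_mul_of_nonneg_left ih (show 0 ≤ 1 + η n by linarith [hη n])
      have h2 := mul_le_mul_of_nonneg_right hP (he n)
      have h3 := mul_nonneg (hη n) (Finset.sum_nonneg fun i (_ : i ∈ Finset.range n) => hb i)
      linarith [h n]
  have hprod : ∀ n, ∏ i ∈ Finset.range n, (1 + η i) ≤ Real.exp (∑' i, η i) := fun n => by
    calc ∏ i ∈ Finset.range n, (1 + η i) ≤ ∏ i ∈ Finset.range n, Real.exp (η i) :=
          Finset.prod_le_prod (fun i _ => by linarith [hη i])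
            fun i _ => by linarith [Real.add_one_le_exp (η i)]
      _ = Real.exp (∑ i ∈ Finset.range n, η i) := (Real.exp_sum _ _).symm
      _ ≤ _ := Real.exp_le_exp.2 (hηs.sum_le_tsum _ fun i _ => hη i)
  have hbound : ∀ n, a n + ∑ i ∈ Finset.range n, b i ≤
      Real.exp (∑' i, η i) * (a 0 + ∑' i, e i) := fun n => by
    refine (key n).trans (mul_le_mul (hprod n) ?_ ?_ (Real.exp_pos _).le)
    · gcongr
      exact hes.sum_le_tsum _ fun i _ => he i
    · exact add_nonneg (ha 0) (Finset.sum_nonneg fun i _ => he i)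
  exact ⟨⟨_, fun k => (le_add_of_nonneg_right (Finset.sum_nonneg fun i _ => hb i)).trans
    (hbound k)⟩, summable_of_sum_range_le hb fun n =>
    (le_add_of_nonneg_left (ha n)).trans (hbound n)⟩

/-- By monotonicity k a_k is at most twice the sum of a over [k/2, k), a difference of partial sums
that tends to 0. -/
theorem isLittleO_one_div_of_antitone {a : ℕ → ℝ} (ha : ∀ k, 0 ≤ a k) (hanti : Antitone a)
    (hs : Summable a) : a =o[atTop] fun k : ℕ => 1 / (k : ℝ) := by
  rw [Asymptotics.isLittleO_iff_tendsto']
  · have h1 := hs.hasSum.tendsto_sum_nat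
    have h2 := h1.comp (Nat.tendsto_div_const_atTop (two_ne_zero))
    have h3 := (h1.sub h2).const_mul 2
    rw [sub_self, mul_zero] at h3
    refine squeeze_zero (fun k => div_nonneg (ha k) (by positivity)) (fun k => ?_) h3
    rw [div_div_eq_mul_div, div_one]
    simp only [Function.comp_apply]
    rw [← Finset.sum_Ico_eq_sub _ (Nat.div_le_self k 2)]
    have h4 := Finset.card_nsmul_le_sum (Finset.Ico (k / 2) k) a (a k)
      fun i hi => hanti (Finset.mem_Ico.1 hi).2.le
    rw [Nat.card_Ico, nsmul_eq_mul] at h4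
    have h5 : (k : ℝ) ≤ 2 * ((k - k / 2 : ℕ) : ℝ) := by
      exact_mod_cast (by omega : k ≤ 2 * (k - k / 2))
    nlinarith [ha k]
  · filter_upwards [eventually_gt_atTop 0] with k hk h
    have : (0 : ℝ) < k := by exact_mod_cast hk
    exact absurd h (by positivity)

end RealSequences

/-! ### From varying norms to a single energy recursion -/

section Energy

variable {W : ℕ → H →L[ℝ] H} {ν μ : ℝ}

theorem rayleigh_mul {T : H →L[ℝ] H} {u : H} (hu : u ≠ 0) :
    ∃ v : Metric.sphere (0 : H) 1, inner ℝ (v : H) (T v) * ‖u‖ ^ 2 = inner ℝ u (T u) := by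
  have hn : ‖u‖ ≠ 0 := norm_ne_zero_iff.2 hu
  refine ⟨⟨‖u‖⁻¹ • u, ?_⟩, ?_⟩
  · rw [mem_sphere_zero_iff_norm, norm_smul, norm_inv, norm_norm, inv_mul_cancel₀ hn]
  · simp only [map_smul, real_inner_smul_left, real_inner_smul_right]
    field_simp

theorem IsMetricSequence.lower_inner (hW : IsMetricSequence W ν μ) (k : ℕ)
    (v : Metric.sphere (0 : H) 1) : ν ≤ inner ℝ (v : H) (W k v) := by
  have := hW.lower k v
  rw [metricNorm_sq (hW.positive k), norm_eq_of_mem_sphere] at this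
  simpa [metricInner] using this

theorem IsMetricSequence.upper_inner (hW : IsMetricSequence W ν μ) (k : ℕ)
    (v : Metric.sphere (0 : H) 1) : inner ℝ (v : H) (W k v) ≤ μ := by
  have := hW.upper k v
  rw [metricNorm_sq (hW.positive k), norm_eq_of_mem_sphere] at this
  simpa [metricInner] using this

theorem IsMetricSequence.minEig_mul_le (hW : IsMetricSequence W ν μ) (k : ℕ) (u : H) :
    minEig (W k) * ‖u‖ ^ 2 ≤ metricNorm (W k) u ^ 2 := by
  rw [metricNorm_sq (hW.positive k)]
  rcases eq_or_ne u 0 with rfl | hu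
  · simp [metricInner]
  obtain ⟨v, hv⟩ := rayleigh_mul (T := W k) hu
  rw [metricInner, ← hv]
  gcongr
  exact ciInf_le ⟨ν, by rintro _ ⟨w, rfl⟩; exact hW.lower_inner k w⟩ v

theorem IsMetricSequence.le_maxEig_mul (hW : IsMetricSequence W ν μ) (k : ℕ) (u : H) :
    metricNorm (W k) u ^ 2 ≤ maxEig (W k) * ‖u‖ ^ 2 := by
  rw [metricNorm_sq (hW.positive k)]
  rcases eq_or_ne u 0 with rfl | hu
  · simp [metricInner]
  obtain ⟨v, hv⟩ := rayleigh_mul (T := W k) hu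
  rw [metricInner, ← hv]
  gcongr
  exact le_ciSup (f := fun w : Metric.sphere (0 : H) 1 => inner ℝ (w : H) (W k w))
    ⟨μ, by rintro _ ⟨w, rfl⟩; exact hW.upper_inner k w⟩ v

/-- Both assumptions on the metrics turn a quasi-Fejér inequality in the varying norms into one
for a suitable sequence of energies. -/
theorem IsMetricSequence.exists_energy (hW : IsMetricSequence W ν μ)
    (hm : QuasiMonotone W ∨ SummableGap W) :
    ∃ (E : ℕ → H → ℝ) (η : ℕ → ℝ) (c C ν₀ : ℝ), 0 < c ∧ 0 < C ∧ 0 < ν₀ ∧ (∀ k, 0 ≤ η k) ∧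
      Summable η ∧ (∀ k u, ν₀ * ‖u‖ ^ 2 ≤ E k u) ∧
      ∀ k u v e b, 0 ≤ e → 0 ≤ b →
        metricNorm (W k) v ^ 2 ≤ metricNorm (W k) u ^ 2 + e - b →
        E (k + 1) v ≤ (1 + η k) * E k u + C * e - c * b := by
  have hν := hW.nu_pos
  -- In the zero space the unit sphere is empty and `minEig` carries no information; there
  -- quasi-monotonicity is trivial.
  have hquasi : QuasiMonotone W ∨ (SummableGap W ∧ Nontrivial H) := by
    rcases hm with hm | hm
    · exact .inl hm
    · rcases subsingleton_or_nontrivial H with hH | hH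
      · refine .inl ⟨0, fun _ => le_rfl, summable_zero, fun k x => ?_⟩
        rw [Subsingleton.elim x 0, metricNorm_sq (hW.positive _), metricNorm_sq (hW.positive _)]
        simp [metricInner]
      · exact .inr ⟨hm, hH⟩
  rcases hquasi with ⟨η, hη, hηs, hmono⟩ | ⟨hgap, hH⟩
  · refine ⟨fun k u => metricNorm (W k) u ^ 2, η, 1, 1 + ∑' i, η i, ν, one_pos,
      add_pos_of_pos_of_nonneg one_pos (tsum_nonneg hη), hν, hη, hηs, hW.lower, fun k u v e b he hb h => ?_⟩
    have h1 := (hmono k v).trans (mul_le_mul_of_nonneg_left h (by linarith [hη k]))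
    have h2 : η k ≤ ∑' i, η i := hηs.le_tsum k fun i _ => hη i
    have h3 := mul_le_mul_of_nonneg_right h2 he
    have h4 := mul_nonneg (hη k) hb
    linarith
  · have hμ : 0 < μ := hν.trans_le hW.nu_le_mu
    have hne : Nonempty (Metric.sphere (0 : H) 1) :=
      (NormedSpace.sphere_nonempty.2 zero_le_one).to_subtype
    have hmin : ∀ k, ν ≤ minEig (W k) := fun k => le_ciInf (hW.lower_inner k)
    have hmax : ∀ k, maxEig (W k) ≤ μ := fun k => ciSup_le (hW.upper_inner k)
    have hle : ∀ k, minEig (W k) ≤ maxEig (W k) := fun k => by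
      obtain ⟨v⟩ := hne
      have h1 := (hW.minEig_mul_le k v).trans (hW.le_maxEig_mul k v)
      rw [norm_eq_of_mem_sphere] at h1
      linarith
    -- With the fixed norm as energy, passing through the metric costs the factor maxEig / minEig,
    -- at most 1 + (maxEig - minEig) / ν.
    refine ⟨fun _ u => ‖u‖ ^ 2, fun k => (maxEig (W k) - minEig (W k)) / ν, 1 / μ, 1 / ν, 1,
      by positivity, by positivity, one_pos,
      fun k => div_nonneg (sub_nonneg.2 (hle k)) hν.le, hgap.div_const ν,
      fun k u => (one_mul _).le, fun k u v e b he hb h => ?_⟩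
    have hk : 0 < minEig (W k) := hν.trans_le (hmin k)
    have h1 : minEig (W k) * ‖v‖ ^ 2 ≤ maxEig (W k) * ‖u‖ ^ 2 + e - b := by
      linarith [hW.minEig_mul_le k v, hW.le_maxEig_mul k u]
    have h2 : ‖v‖ ^ 2 ≤ (1 + (maxEig (W k) - minEig (W k)) / minEig (W k)) * ‖u‖ ^ 2
        + 1 / minEig (W k) * e - 1 / minEig (W k) * b := by
      refine le_of_mul_le_mul_left ?_ hk
      field_simp
      linarith
    have h3 : (maxEig (W k) - minEig (W k)) / minEig (W k) * ‖u‖ ^ 2 ≤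
        (maxEig (W k) - minEig (W k)) / ν * ‖u‖ ^ 2 := by
      have := sub_nonneg.2 (hle k)
      gcongr
      exact hmin k
    have h4 : 1 / minEig (W k) * e ≤ 1 / ν * e := by
      gcongr
      exact hmin k
    have h5 : 1 / μ * b ≤ 1 / minEig (W k) * b := by
      gcongr
      exact (hle k).trans (hmax k)
    linarith

end Energy

/-! ### Boundedness, weakly compact trapping and the rate -/

section Convergence

variable {f g : H → EReal} {W : ℕ → H →L[ℝ] H} {ν μ : ℝ} {x y : ℕ → H}
  {γ lam : ℕ → ℝ} {δ Γ : ℝ} {z : H}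

theorem objective_le_of_mem_argmin {W : H →L[ℝ] H} (S : IsSetting f g W ν)
    (hz : z ∈ argmin fun z => f z + g z) : z ∈ dom g ∧
    ∀ w ∈ dom g, objective f g z ≤ objective f g w := by
  have hzd : z ∈ dom g := by
    obtain ⟨w, hw⟩ := S.right.proper
    have h1 : f z + g z ≤ f w + g w := hz w
    by_contra h
    have h2 : g z = ⊤ := not_lt_top_iff.1 h
    rw [h2, EReal.add_top_of_ne_bot (S.left.ne_bot z), S.coe_add hw,
      top_le_iff] at h1
    exact EReal.coe_ne_top _ h1
  refine ⟨hzd, fun w hw => ?_⟩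
  have h1 : f z + g z ≤ f w + g w := hz w
  rwa [S.coe_add hzd, S.coe_add hw, EReal.coe_le_coe_iff] at h1

variable [CompleteSpace H]

theorem linDecrease_fbStep_nonpos {W : H →L[ℝ] H} (S : IsSetting f g W ν) {c : ℝ} (hc : 0 < c)
    {w : H} (hw : w ∈ dom g) : linDecrease f g w (fbStep f g W c w) ≤ 0 := by
  have h := S.linDecrease_le hc hw
  have h1 := sq_nonneg (metricNorm W (fbStep f g W c w - w))
  by_contra! h2
  nlinarith [mul_pos hc h2]

theorem IsVMFBS.antitone_objective (halg : IsVMFBS f g W x y γ lam)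
    (S : ∀ k, IsSetting f g (W k) ν) (hδ : δ < 1)
    (harm : ∀ k, objective f g (x (k + 1)) - objective f g (x k)
      ≤ (1 - δ) * lam k * linDecrease f g (x k) (fbStep f g (W k) (γ k) (x k))) :
    Antitone fun k => objective f g (x k) := by
  refine antitone_nat_of_succ_le fun k => ?_
  have h1 := linDecrease_fbStep_nonpos (S k) (halg.step_pos k) (halg.mem_dom S k)
  have h2 := mul_nonneg (mul_nonneg (sub_nonneg.2 hδ.le) (halg.relax_pos k).le)
    (neg_nonneg.2 h1)
  linarith [harm k]

theorem IsVMFBS.bounded_and_summable (halg : IsVMFBS f g W x y γ lam)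
    (S : ∀ k, IsSetting f g (W k) ν) (hW : IsMetricSequence W ν μ)
    (hm : QuasiMonotone W ∨ SummableGap W) (hΓ : ∀ k, γ k ≤ Γ) (hδ : δ < 1)
    (harm : ∀ k, objective f g (x (k + 1)) - objective f g (x k)
      ≤ (1 - δ) * lam k * linDecrease f g (x k) (fbStep f g (W k) (γ k) (x k)))
    (hz : z ∈ argmin fun z => f z + g z) :
    (∃ R, ∀ k, ‖x k‖ ≤ R) ∧
      Summable fun k => γ k * lam k * (objective f g (x k) - objective f g z) := by
  obtain ⟨hzd, hzmin⟩ := objective_le_of_mem_argmin (S 0) hz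
  have hanti := halg.antitone_objective S hδ harm
  obtain ⟨E, η, c, C, ν₀, hc, hC, hν₀, hη, hηs, hElow, hE⟩ := hW.exists_energy hm
  have hmin : ∀ k, 0 ≤ objective f g (x k) - objective f g z := fun k =>
    sub_nonneg.2 (hzmin _ (halg.mem_dom S k))
  have hdec : ∀ k, 0 ≤ objective f g (x k) - objective f g (x (k + 1)) := fun k =>
    sub_nonneg.2 (hanti k.le_succ)
  have hΓ0 : 0 < Γ := (halg.step_pos 0).trans_le (hΓ 0)
  have hδ0 : 0 < 1 - δ := sub_pos.2 hδ
  have hes : Summable fun k => objective f g (x k) - objective f g (x (k + 1)) :=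
    summable_of_sum_range_le hdec (c := objective f g (x 0) - objective f g z) fun n => by
      rw [Finset.sum_range_sub' fun k => objective f g (x k)]
      linarith [hmin n]
  have hb : ∀ k, 0 ≤ 2 * (γ k * lam k) * (objective f g (x k) - objective f g z) := fun k => by
    have := (halg.step_pos k).le
    have := (halg.relax_pos k).le
    have := hmin k
    positivity
  have he : ∀ k, 0 ≤ 2 * Γ / (1 - δ) * (objective f g (x k) - objective f g (x (k + 1))) :=
    fun k => by
    have := hdec k
    positivity
  obtain ⟨⟨M, hM⟩, hs⟩ := bounded_and_summable_of_quasiFejer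
    (a := fun k => E k (x k - z)) (η := η)
    (e := fun k => C * (2 * Γ / (1 - δ) * (objective f g (x k) - objective f g (x (k + 1)))))
    (b := fun k => c * (2 * (γ k * lam k) * (objective f g (x k) - objective f g z)))
    (fun k => (by positivity : 0 ≤ ν₀ * ‖x k - z‖ ^ 2).trans (hElow k _)) hη
    (fun k => mul_nonneg hC.le (he k)) (fun k => mul_nonneg hc.le (hb k)) hηs
    ((hes.mul_left _).mul_left _) fun k => by
      refine hE k _ _ _ _ (he k) (hb k) ?_
      have harm' := harm k
      rw [halg.x_succ] at harm'
      have h := (S k).metricNorm_sub_sq_le (halg.step_pos k) (halg.relax_pos k)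
        (halg.relax_le_one k) (halg.mem_dom S k) hδ harm' hzd
      rw [← halg.x_succ] at h
      have h2 : 2 * γ k / (1 - δ) * (objective f g (x k) - objective f g (x (k + 1))) ≤
          2 * Γ / (1 - δ) * (objective f g (x k) - objective f g (x (k + 1))) := by
        have := hdec k
        have := hΓ k
        gcongr
      linarith
  constructor
  · refine ⟨√(M / ν₀) + ‖z‖, fun k => ?_⟩
    have h1 : ‖x k - z‖ ≤ √(M / ν₀) := by
      refine Real.le_sqrt_of_sq_le ?_
      rw [le_div_iff₀ hν₀, mul_comm]
      exact (hElow k _).trans (hM k)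
    have h2 : ‖x k‖ ≤ ‖x k - z‖ + ‖z‖ := by simpa using norm_add_le (x k - z) z
    linarith
  · refine (hs.mul_left (1 / (2 * c))).congr fun k => ?_
    field_simp

/-- The iterates and all the trial points lie in a convex weakly compact subset of the domain
of `g`. -/
theorem IsVMFBS.exists_weaklyCompact (halg : IsVMFBS f g W x y γ lam)
    (S : ∀ k, IsSetting f g (W k) ν)
    (hlip : ∀ A : Set H, A ⊆ dom g → IsWeaklyCompact A →
      ∃ L : ℝ≥0, LipschitzOnWith L (grad f) A)
    (hanti : Antitone fun k => objective f g (x k)) {R : ℝ} (hR : ∀ k, ‖x k‖ ≤ R)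
    (hΓ0 : 0 < Γ) :
    ∃ K : Set H, K ⊆ dom g ∧ Convex ℝ K ∧ IsWeaklyCompact K ∧ (∀ k, x k ∈ K) ∧
      ∀ k c, 0 < c → c ≤ Γ → fbStep f g (W k) c (x k) ∈ K := by
  have hf := (S 0).left
  have hg := (S 0).right
  have hν := (S 0).nu_pos
  have hsub : ∀ c r : ℝ, {w | g w ≤ (c : EReal)} ∩ Metric.closedBall 0 r ⊆ dom g ∧
      Convex ℝ ({w | g w ≤ (c : EReal)} ∩ Metric.closedBall 0 r) ∧
      IsWeaklyCompact ({w | g w ≤ (c : EReal)} ∩ Metric.closedBall 0 r) := fun c r => by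
    have hconv := (hg.convex_sublevel c).inter (convex_closedBall (0 : H) r)
    exact ⟨fun w hw => lt_of_le_of_lt hw.1 (EReal.coe_lt_top _), hconv,
      isWeaklyCompact_of_convex hconv ((hg.lsc.isClosed_preimage _).inter Metric.isClosed_closedBall)
        inter_subset_right⟩
  have hmem : ∀ {c r : ℝ} {w : H}, w ∈ dom g → (g w).toReal ≤ c → ‖w‖ ≤ r →
      w ∈ {w | g w ≤ (c : EReal)} ∩ Metric.closedBall 0 r := fun {c r w} hw h1 h2 => by
    refine ⟨?_, by simpa using h2⟩
    simp only [mem_ofPred_eq]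
    rwa [← hg.coe_toReal hw, EReal.coe_le_coe_iff]
  have hx := halg.mem_dom S
  have hR0 : 0 ≤ R := (norm_nonneg _).trans (hR 0)
  obtain ⟨A, B, hB, hAB⟩ := hf.exists_lower_bound
  obtain ⟨A', B', hB', hAB'⟩ := hg.exists_lower_bound
  -- Since F(x k) ≤ F(x 0) and f is linearly bounded below on the ball, c₀ bounds g along the
  -- iterates.
  set c₀ := objective f g (x 0) - A + B * R with hc₀
  have hgx : ∀ k, (g (x k)).toReal ≤ c₀ := fun k => by
    have h1 : objective f g (x k) ≤ objective f g (x 0) := hanti k.zero_le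
    have h2 := hAB (x k) ((S 0).dom_subset (hx k))
    have h3 := mul_le_mul_of_nonneg_left (hR k) hB
    have h4 : objective f g (x k) = (f (x k)).toReal + (g (x k)).toReal := rfl
    linarith
  -- The Lipschitz hypothesis is first used on a set containing only the iterates, to bound their
  -- gradients; trial points are not yet controlled.
  obtain ⟨L, hL⟩ := hlip _ (hsub c₀ R).1 (hsub c₀ R).2.2
  set M := ‖grad f (x 0)‖ + L * (2 * R) with hMdef
  have hM0 : 0 ≤ M := by positivity
  have hM : ∀ k, ‖grad f (x k)‖ ≤ M := fun k => by
    have h1 := hL.norm_sub_le (hmem (hx k) (hgx k) (hR k)) (hmem (hx 0) (hgx 0) (hR 0))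
    have h2 : ‖x k - x 0‖ ≤ 2 * R := by linarith [norm_sub_le (x k) (x 0), hR k, hR 0]
    have h3 := mul_le_mul_of_nonneg_left h2 L.coe_nonneg
    linarith [norm_le_norm_add_norm_sub' (grad f (x k)) (grad f (x 0))]
  set P := |c₀ - A' + B' * R| with hP
  -- The displacement n satisfies ν n² ≤ Γ(P + (B' + M) n): either n ≤ 1, or dividing by n gives the
  -- second term.
  set N := 1 + Γ * (P + (B' + M)) / ν with hN
  have hP0 : 0 ≤ P := abs_nonneg _
  have htrial : ∀ k c, 0 < c → c ≤ Γ →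
      ‖fbStep f g (W k) c (x k) - x k‖ ≤ N := fun k c h0 h1 => by
    have hp := (S k).fbStep_mem (x := x k) h0
    have h2 := (S k).linDecrease_le h0 (hx k)
    have h3 := (S k).lower (fbStep f g (W k) c (x k) - x k)
    unfold linDecrease at h2
    set p := fbStep f g (W k) c (x k)
    set n := ‖p - x k‖ with hn
    have hn0 : 0 ≤ n := norm_nonneg _
    have h4 : -(n * M) ≤ inner ℝ (p - x k) (grad f (x k)) := by
      have h5 := neg_le_of_abs_le (abs_real_inner_le_norm (p - x k) (grad f (x k)))
      have h6 := mul_le_mul_of_nonneg_left (hM k) hn0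
      linarith
    have h5 : A' - B' * (n + R) ≤ (g p).toReal := by
      have h6 : ‖p‖ ≤ n + R := by
        have : ‖p‖ ≤ ‖p - x k‖ + ‖x k‖ := by simpa using norm_add_le (p - x k) (x k)
        linarith [hR k]
      have h7 := mul_le_mul_of_nonneg_left h6 hB'
      linarith [hAB' p hp]
    have h6 : ν * n ^ 2 ≤ Γ * (P + (B' + M) * n) := by
      have h7 : -((g p).toReal - (g (x k)).toReal + inner ℝ (p - x k) (grad f (x k))) ≤
          P + (B' + M) * n := by
        linarith [le_abs_self (c₀ - A' + B' * R), hgx k]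
      have h8 := mul_le_mul_of_nonneg_left h7 h0.le
      have h9 : c * (P + (B' + M) * n) ≤ Γ * (P + (B' + M) * n) := by gcongr
      linarith
    rcases le_or_gt n 1 with h7 | h7
    · have : 0 ≤ Γ * (P + (B' + M)) / ν := by positivity
      linarith
    · have h8 : n ≤ Γ * (P + (B' + M)) / ν := by
        rw [le_div_iff₀ hν]
        refine le_of_mul_le_mul_right ?_ (zero_lt_one.trans h7)
        have h9 := mul_le_mul_of_nonneg_left h7.le (show 0 ≤ Γ * P by positivity)
        linarith
      linarith
  have hN0 : 0 ≤ N := (norm_nonneg _).trans (htrial 0 Γ hΓ0 le_rfl)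
  refine ⟨_, (hsub (c₀ + N * M) (R + N)).1, (hsub (c₀ + N * M) (R + N)).2.1,
    (hsub (c₀ + N * M) (R + N)).2.2, fun k => hmem (hx k) ?_ ?_, fun k c h0 h1 =>
    hmem ((S k).fbStep_mem h0) ?_ ?_⟩
  · linarith [hgx k, mul_nonneg hN0 hM0]
  · linarith [hR k]
  -- A nonpositive linearized decrease means g grows by at most the displacement times the gradient
  -- norm, whence the level c₀ + N M.
  · have h2 := linDecrease_fbStep_nonpos (S k) h0 (hx k)
    unfold linDecrease at h2
    have h3 := neg_le_of_abs_le (abs_real_inner_le_norm (fbStep f g (W k) c (x k) - x k)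
      (grad f (x k)))
    have h4 : ‖fbStep f g (W k) c (x k) - x k‖ * ‖grad f (x k)‖ ≤ N * M :=
      mul_le_mul (htrial k c h0 h1) (hM k) (norm_nonneg _) hN0
    linarith [hgx k]
  · have h2 : ‖fbStep f g (W k) c (x k)‖ ≤ ‖fbStep f g (W k) c (x k) - x k‖ + ‖x k‖ := by
      simpa using norm_add_le (fbStep f g (W k) c (x k) - x k) (x k)
    linarith [htrial k c h0 h1, hR k]

theorem IsVMFBS.isLittleO (halg : IsVMFBS f g W x y γ lam)
    (S : ∀ k, IsSetting f g (W k) ν) (hW : IsMetricSequence W ν μ)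
    (hm : QuasiMonotone W ∨ SummableGap W) (hΓ : ∀ k, γ k ≤ Γ) (hδ : δ < 1)
    (harm : ∀ k, objective f g (x (k + 1)) - objective f g (x k)
      ≤ (1 - δ) * lam k * linDecrease f g (x k) (fbStep f g (W k) (γ k) (x k)))
    (hz : z ∈ argmin fun z => f z + g z) (hγ : 0 < ⨅ k, γ k) (hl : 0 < ⨅ k, lam k) :
    (fun k : ℕ => (f (x k) + g (x k) - ⨅ z, (f z + g z)).toReal)
      =o[atTop] fun k : ℕ => 1 / (k : ℝ) := by
  obtain ⟨hzd, hzmin⟩ := objective_le_of_mem_argmin (S 0) hz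
  have hinf : ⨅ z, (f z + g z) = ((objective f g z : ℝ) : EReal) := by
    rw [← (S 0).coe_add hzd]
    exact le_antisymm (iInf_le _ z) (le_iInf hz)
  have hx := halg.mem_dom S
  have hmin : ∀ k, 0 ≤ objective f g (x k) - objective f g z := fun k =>
    sub_nonneg.2 (hzmin _ (hx k))
  have hval : ∀ k, (f (x k) + g (x k) - ⨅ z, (f z + g z)).toReal =
      objective f g (x k) - objective f g z := fun k => by
    rw [hinf, (S 0).coe_add (hx k), ← EReal.coe_sub, EReal.toReal_coe]
  simp only [hval]
  have hanti := halg.antitone_objective S hδ harm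
  refine isLittleO_one_div_of_antitone hmin (fun a b hab => sub_le_sub_right (hanti hab) _) ?_
  have hs := (halg.bounded_and_summable S hW hm hΓ hδ harm hz).2
  set a := ⨅ k, γ k
  set b := ⨅ k, lam k
  have ha : ∀ k, a ≤ γ k := fun k =>
    ciInf_le ⟨0, by rintro _ ⟨j, rfl⟩; exact (halg.step_pos j).le⟩ k
  have hb : ∀ k, b ≤ lam k := fun k =>
    ciInf_le ⟨0, by rintro _ ⟨j, rfl⟩; exact (halg.relax_pos j).le⟩ k
  refine Summable.of_nonneg_of_le hmin (fun k => ?_) (hs.mul_left (1 / (a * b)))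
  have h1 : a * b ≤ γ k * lam k := mul_le_mul (ha k) (hb k) hl.le (halg.step_pos k).le
  rw [← mul_assoc, one_div_mul_eq_div]
  refine le_mul_of_one_le_left (hmin k) ?_
  rwa [one_le_div (by positivity)]

end Convergence

end VMFBS

end

/-! ### Assembly over the four line searches -/

theorem propositionp {H : Type*} [NormedAddCommGroup H] [InnerProductSpace ℝ H] [CompleteSpace H]
    (f g : H → EReal) (hf : VMFBS.IsGammaZero f) (hg : VMFBS.IsGammaZero g)
    (hdom : VMFBS.dom g ⊆ VMFBS.dom f)
    (hdiff : VMFBS.GateauxDifferentiableOn f (VMFBS.dom g))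
    (W : ℕ → H →L[ℝ] H) (ν μ : ℝ) (hW : VMFBS.IsMetricSequence W ν μ)
    (hmetric : VMFBS.QuasiMonotone W ∨ VMFBS.SummableGap W)
    (x y : ℕ → H) (γ lam : ℕ → ℝ) (halg : VMFBS.IsVMFBS f g W x y γ lam) :
    (∀ L : ℝ≥0, LipschitzOnWith L (VMFBS.grad f) (VMFBS.dom g) →
      (∀ δ θ γbar : ℝ, VMFBS.LS1 f g W x γ lam δ θ γbar →
        VMFBS.stepBound γbar (2 * δ * θ * ν) L (⨆ k, lam k) ≤ ⨅ k, γ k) ∧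
      (∀ δ θ lambar : ℝ,
        VMFBS.LS2 f g W x γ lam δ θ lambar ∨ VMFBS.LS4 f g W x y γ lam δ θ lambar →
        VMFBS.stepBound lambar (2 * δ * θ * ν) L (⨆ k, γ k) ≤ ⨅ k, lam k) ∧
      (∀ δ θ γbar : ℝ, VMFBS.LS3 f g W x γ lam δ θ γbar →
        VMFBS.stepBound γbar (δ * θ * ν) L (⨆ k, lam k) ≤ ⨅ k, γ k)) ∧
    ((VMFBS.argmin fun z => f z + g z).Nonempty →
      (∀ A : Set H, A ⊆ VMFBS.dom g → VMFBS.IsWeaklyCompact A →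
        ∃ L : ℝ≥0, LipschitzOnWith L (VMFBS.grad f) A) →
      (∃ δ θ bar : ℝ,
        VMFBS.LS1 f g W x γ lam δ θ bar ∨ VMFBS.LS2 f g W x γ lam δ θ bar ∨
        VMFBS.LS3 f g W x γ lam δ θ bar ∨ VMFBS.LS4 f g W x y γ lam δ θ bar) →
      (0 < ⨅ k, γ k) ∧ (0 < ⨅ k, lam k) ∧
      (fun k : ℕ => (f (x k) + g (x k) - ⨅ z, (f z + g z)).toReal)
        =o[atTop] fun k : ℕ => 1 / (k : ℝ)) := by
  have S : ∀ k, VMFBS.IsSetting f g (W k) ν := fun k =>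
    ⟨hf, hg, hdom, hdiff, hW.positive k, hW.nu_pos, hW.lower k⟩
  have hx := halg.mem_dom S
  have hy : ∀ k, y k ∈ VMFBS.dom g := fun k => halg.y_eq k ▸ (S k).fbStep_mem (halg.step_pos k)
  refine ⟨fun L hL => ⟨fun δ θ bar h => ?_, fun δ θ bar h => ?_, fun δ θ bar h => ?_⟩,
    fun ⟨z, hz⟩ hlip ⟨δ, θ, bar, h⟩ => ?_⟩
  · exact h.stepBound_le halg S subset_rfl hg.convex_dom hL hx
      fun k c hc _ => (S k).fbStep_mem hc
  · rcases h with h | h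
    · exact h.stepBound_le halg S subset_rfl hg.convex_dom hL hx hy
    · exact h.stepBound_le halg S subset_rfl hg.convex_dom hL hx hy
  · exact h.stepBound_le halg S subset_rfl hg.convex_dom hL hx
      fun k c hc _ => (S k).fbStep_mem hc
  have hν := hW.nu_pos
  -- The scheme common to all rules: Γ is the initial trial stepsize for LS1 and LS3, and the
  -- supremum of the stepsizes for LS2 and LS4.
  have hbound : ∀ Γ : ℝ, δ < 1 → (∀ k, γ k ≤ Γ) →
      (∀ k, VMFBS.objective f g (x (k + 1)) - VMFBS.objective f g (x k)
        ≤ (1 - δ) * lam k *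
          VMFBS.linDecrease f g (x k) (VMFBS.fbStep f g (W k) (γ k) (x k))) →
      (∀ (K : Set H) (L : ℝ≥0), K ⊆ VMFBS.dom g → Convex ℝ K →
        LipschitzOnWith L (VMFBS.grad f) K → (∀ k, x k ∈ K) →
        (∀ k c, 0 < c → c ≤ Γ → VMFBS.fbStep f g (W k) c (x k) ∈ K) →
        (0 < ⨅ k, γ k) ∧ (0 < ⨅ k, lam k)) →
      (0 < ⨅ k, γ k) ∧ (0 < ⨅ k, lam k) ∧
      (fun k : ℕ => (f (x k) + g (x k) - ⨅ z, (f z + g z)).toReal)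
        =o[atTop] fun k : ℕ => 1 / (k : ℝ) := fun Γ hδ hΓ harm hinf => by
    obtain ⟨R, hR⟩ := (halg.bounded_and_summable S hW hmetric hΓ hδ harm hz).1
    obtain ⟨K, hKg, hK, hKc, hxK, hyK⟩ := halg.exists_weaklyCompact S hlip
      (halg.antitone_objective S hδ harm) hR ((halg.step_pos 0).trans_le (hΓ 0))
    obtain ⟨L, hL⟩ := hlip K hKg hKc
    obtain ⟨h1, h2⟩ := hinf K L hKg hK hL hxK hyK
    exact ⟨h1, h2, halg.isLittleO S hW hmetric hΓ hδ harm hz h1 h2⟩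
  have hγs : BddAbove (range γ) → ∀ k, γ k ≤ ⨆ k, γ k := fun hb k => le_ciSup hb k
  have hlams : 0 < ⨆ k, lam k := (halg.relax_pos 0).trans_le (halg.le_iSup_relax 0)
  rcases h with h | h | h | h
  · have hδ := h.delta.1
    have hθ := h.theta.1
    refine hbound bar h.delta.2 (fun k => (h.search k).le_bar h.bar h.theta) (fun k => ?_)
      fun K L hKg hK hL hxK hyK => ⟨?_, h.inf_relax⟩
    · rw [halg.x_succ]
      exact (S k).objective_sub_le_of_descentCond (halg.step_pos k) (halg.relax_pos k)
        (halg.relax_le_one k) (hx k) hδ (h.search k).1.2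
    · exact (VMFBS.stepBound_pos h.bar (by positivity) hlams).trans_le
        (h.stepBound_le halg S hKg hK hL hxK hyK)
  · have hδ := h.delta.1
    have hθ := h.theta.1
    refine hbound _ h.delta.2 (hγs h.sup_step) (fun k => ?_)
      fun K L hKg hK hL hxK hyK => ⟨h.inf_step, ?_⟩
    · rw [halg.x_succ]
      exact (S k).objective_sub_le_of_descentCond (halg.step_pos k) (halg.relax_pos k)
        (halg.relax_le_one k) (hx k) hδ (h.search k).1.2
    · exact (VMFBS.stepBound_pos h.bar.1 (by positivity)
        ((halg.step_pos 0).trans_le (hγs h.sup_step 0))).trans_le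
        (h.stepBound_le halg S hKg hK hL hxK
          fun k => halg.y_eq k ▸ hyK k _ (halg.step_pos k) (hγs h.sup_step k))
  · have hδ := h.delta.1
    have hθ := h.theta.1
    refine hbound bar h.delta.2 (fun k => (h.search k).le_bar h.bar h.theta) (fun k => ?_)
      fun K L hKg hK hL hxK hyK => ⟨?_, h.inf_relax⟩
    · rw [halg.x_succ]
      exact (S k).objective_sub_le_of_descentCond (halg.step_pos k) (halg.relax_pos k)
        (halg.relax_le_one k) (hx k) hδ ((S k).descentCond_of_lipschitzCond (halg.step_pos k)
          (halg.relax_pos k) (halg.relax_le_one k) (hx k) (h.search k).1.2)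
    · exact (VMFBS.stepBound_pos h.bar (by positivity) hlams).trans_le
        (h.stepBound_le halg S hKg hK hL hxK hyK)
  · have hδ := h.delta.1
    have hθ := h.theta.1
    refine hbound _ h.delta.2 (hγs h.sup_step) (fun k => ?_)
      fun K L hKg hK hL hxK hyK => ⟨h.inf_step, ?_⟩
    · have h1 : VMFBS.ArmijoCond f g (W k) δ (x k) (y k) (γ k) (lam k) := (h.search k).1.2
      rw [(S k).armijoCond_iff (hx k) (hy k) (halg.x_succ k ▸ hx (k + 1)), ← halg.x_succ,
        halg.y_eq] at h1
      exact h1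
    · exact (VMFBS.stepBound_pos h.bar.1 (by positivity)
        ((halg.step_pos 0).trans_le (hγs h.sup_step 0))).trans_le
        (h.stepBound_le halg S hKg hK hL hxK
          fun k => halg.y_eq k ▸ hyK k _ (halg.step_pos k) (hγs h.sup_step k))
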